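/- **Setting.** All dimensions $n,N,k,m$ are positive integers. Let $\mathscr Z$ be the zero-padding sequence on $(\mathbb R^n)_{n\ge1}$: dimensions ordered by $\le$, embeddings $\zeta_{N,n}(x)=(x,0_{N-n})$ for $n\le N$. Let $\mathscr D$ be the duplication sequence: dimensions ordered by divisibility, embeddings $\delta_{N,n}(x)=x\otimes\mathbb 1_{N/n}$ (each entry repeated $N/n$ times) for $n\mid N$. A construction $\mathcal F$ is a finite composition of Cartesian products, tensor products and symmetric powers $\mathrm{Sym}^j$ (symmetric tensors); its degree is defined by $\deg\mathrm{id}=1$, $\deg(\mathcal F_1\times\mathcal F_2)=\max(\deg\mathcal F_1,\deg\mathcal F_2)$, $\deg(\mathcal F_1\otimes\mathcal F_2)=\deg\mathcal F_1+\deg\mathcal F_2$, $\deg\mathrm{Sym}^j\mathcal F_1=j\deg\mathcal F_1$. Let $\mathbb V_n=\mathcal F(\mathbb R^n)$, with the inner product extended from the standard one on $\mathbb R^n$ (Frobenius on tensors); $\mathcal F$ acts on linear maps functorially. An FS-pair of degree $D=\deg\mathcal F$ is $(\mathscr U,\mathscr L)=(\mathcal F(\mathscr Z),\mathcal F(\mathscr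 D))$ or $(\mathcal F(\mathscr D),\mathcal F(\mathscr Z))$. Write $\varphi_{N,n}$, $\psi_{N,n}:\mathbb V_n\to\mathbb V_N$ for the embeddings of $\mathscr U$, $\mathscr L$, and $\preceq_{\mathscr U}$, $\preceq_{\mathscr L}$ for their orders; ${}^\star$ denotes the adjoint. For $f:[m]\to[n]$ let $\rho(f):\mathbb V_n\to\mathbb V_m$ be induced by $(\rho(f)x)_i=x_{f(i)}$ on $\mathbb R^n$; the symmetric group $S_n$ acts on $\mathbb V_n$ by $g\cdot x=\rho(g^{-1})x$. The de Finetti map $L_{k,n}:\mathbb V_n\to\mathbb V_k$ is the random linear map $\rho(f)$ with $f:[k]\to[n]$ uniformly random if $\mathscr U=\mathcal F(\mathscr D)$, and $\rho(f)^\star$ with $f:[n]\to[k]$ uniformly random if $\mathscr U=\mathcal F(\mathscr Z)$. For a polynomial $q$ on $\mathbb V_k$ and $k\preceq_{\mathscr L}n$ put $\mathrm{sym}_n^{\mathscr L}q(x)=\frac1{n!}\sum_{g\in S_n}q(\psi_{n,k}^\star\, g\cdot x)$. Let $\Omega_n\subset\mathbb V_n$ be nonempty, compact and FS-compatible: each $\Omega_n$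 is $S_n$-invariant, $\varphi_{N,n}\Omega_n\subset\Omega_N$ for $n\preceq_{\mathscr U}N$, and $\psi_{N,n}^\star\Omega_N\subset\Omega_n$ for $n\preceq_{\mathscr L}N$. Let $(p_n)$ be a freely-described cost over $\mathscr U$ of degree at most $d$: each $p_n$ is an $S_n$-invariant polynomial on $\mathbb V_n$ of degree at most $d$, and $p_N\circ\varphi_{N,n}=p_n$ for $n\preceq_{\mathscr U}N$. Let $u_n=\inf_{\Omega_n}p_n$ and $u_\infty=\inf_n u_n$. **Theorem.** 1. (Dual cost) There are $k$ and an $S_k$-invariant polynomial $q_k$ on $\mathbb V_k$ of degree at most $d$ with $$p_n(x)=\mathbb E[q_k(L_{k,n}x)]\quad\text{for all } n \text{ and all } x\in\mathbb V_n.\tag{$*$}$$ If polynomials $q_{k_1}$ on $\mathbb V_{k_1}$ and $q_{k_2}$ on $\mathbb V_{k_2}$ both satisfy $(*)$, then $\mathrm{sym}_n^{\mathscr L}q_{k_1}=\mathrm{sym}_n^{\mathscr L}q_{k_2}$ whenever $k_1,k_2\preceq_{\mathscr L}n$. Moreover $u_\infty>-\infty$. In the following, $q_k$ is any polynomial on any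 $\mathbb V_k$ satisfying $(*)$, and $\ell_n=\inf_{\Omega_n}\mathrm{sym}_n^{\mathscr L}q_k$ for $k\preceq_{\mathscr L}n$. 2. (Reformulation) $u_\infty=\inf\mathbb E_{\mu_k}q_k$ over all freely-described measures $(\mu_n)$ over $\mathscr L$, i.e. sequences of $S_n$-invariant Borel probability measures $\mu_n$ on $\Omega_n$ such that the push-forward of $\mu_N$ under $\psi_{N,n}^\star$ is $\mu_n$ whenever $n\preceq_{\mathscr L}N$. 3. (Freely-symmetrized bounds) $\ell_n\le\ell_N\le u_\infty$ whenever $k\preceq_{\mathscr L}n\preceq_{\mathscr L}N$, and $\sup_{n\succeq_{\mathscr L}k}\ell_n=u_\infty$. 4. (Rate I) If $\mathscr U=\mathcal F(\mathscr D)$ and $k\le n$, then $u_n-\ell_n\le\frac{k(k-1)}n\sup_{x\in\Omega_k}|q_k(x)|$. 5. (Rate II) If $\mathscr U=\mathcal F(\mathscr Z)$ and $k\mid n$, then $$u_n-\ell_n\le 2D\sqrt{\frac{k(k-1)}{n/k}}\;\Big(\sup_{x\in\mathrm{conv}\,\Omega_k}\|\nabla q_k(x)\|_\infty\Big)\max_{x\in\Omega_n}\|x\|_1,$$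 where $\|\cdot\|_1$ is the $\ell_1$ norm in the extended coordinates (the sum of the absolute values of all coordinates, resp. tensor entries) and $\|\cdot\|_\infty$ is its dual norm. Moreover there is a constant $C$, independent of $n$, such that $u_n-\ell_n\le C\sqrt{\frac{k(k-1)}{n/k}}$ for all $n$ divisible by $k$. -/

import Mathlib

open MeasureTheory

noncomputable section

namespace FSPair

/-! ## Standard constructions applied to the spaces `ℝⁿ` -/

/-- Sequences of standard operations on vector spaces: the identity, Cartesian products,
tensor products, and symmetric powers. -/
inductive Construction : Type
  | id : Construction
  | prod : Construction → Construction → Construction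
  | tensor : Construction → Construction → Construction
  | sym : ℕ → Construction → Construction

namespace Construction

/-- The degree of a construction. -/
def deg : Construction → ℕ
  | .id => 1
  | .prod F G => max F.deg G.deg
  | .tensor F G => F.deg + G.deg
  | .sym k F => k * F.deg

/-- Index set of the extended coordinates on `F(ℝⁿ)`. A tensor product `ℝ^A ⊗ ℝ^B` is identified
with `ℝ^(A × B)` and a tensor power `(ℝ^A)^{⊗ k}` with `ℝ^(Fin k → A)`. -/
def Idx : Construction → ℕ → Type
  | .id, n => Fin n
  | .prod F G, n => F.Idx n ⊕ G.Idx n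
  | .tensor F G, n => F.Idx n × G.Idx n
  | .sym k F, n => Fin k → F.Idx n

instance instFintypeIdx : ∀ (F : Construction) (n : ℕ), Fintype (F.Idx n)
  | .id, n => inferInstanceAs (Fintype (Fin n))
  | .prod F G, n =>
    letI := instFintypeIdx F n
    letI := instFintypeIdx G n
    inferInstanceAs (Fintype (F.Idx n ⊕ G.Idx n))
  | .tensor F G, n =>
    letI := instFintypeIdx F n
    letI := instFintypeIdx G n
    inferInstanceAs (Fintype (F.Idx n × G.Idx n))
  | .sym k F, n =>
    letI := instFintypeIdx F n
    inferInstanceAs (Fintype (Fin k → F.Idx n))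

/-- The space `F(ℝⁿ)` in extended coordinates. The tensor product of two subspaces is the span of
the elementary tensors, and the `k`-th symmetric power of a subspace `W` consists of the elements
of `W^{⊗ k}` that are invariant under permutations of the `k` tensor factors. -/
def coords : (F : Construction) → (n : ℕ) → Submodule ℝ (F.Idx n → ℝ)
  | .id, _ => ⊤
  | .prod F G, n =>
    (F.coords n).comap (LinearMap.funLeft ℝ ℝ (Sum.inl : F.Idx n → F.Idx n ⊕ G.Idx n)) ⊓
      (G.coords n).comap (LinearMap.funLeft ℝ ℝ (Sum.inr : G.Idx n → F.Idx n ⊕ G.Idx n))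
  | .tensor F G, n =>
    Submodule.span ℝ {z : F.Idx n × G.Idx n → ℝ |
      ∃ v ∈ F.coords n, ∃ w ∈ G.coords n, z = fun a => v a.1 * w a.2}
  | .sym k F, n =>
    Submodule.span ℝ {z : (Fin k → F.Idx n) → ℝ |
      ∃ v : Fin k → F.Idx n → ℝ, (∀ i, v i ∈ F.coords n) ∧ z = fun a => ∏ i, v i (a i)} ⊓
    ⨅ σ : Equiv.Perm (Fin k), LinearMap.eqLocus
      (LinearMap.funLeft ℝ ℝ (fun a : Fin k → F.Idx n => a ∘ σ)) LinearMap.id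

/-- The matrix, in extended coordinates, of the linear map `F(M) : F(ℝⁿ) → F(ℝᵐ)` induced by
a linear map `M : ℝⁿ → ℝᵐ`: direct sums, Kronecker products and Kronecker powers. -/
def mat : (F : Construction) → {m n : ℕ} →
    Matrix (Fin m) (Fin n) ℝ → Matrix (F.Idx m) (F.Idx n) ℝ
  | .id, _, _, M => M
  | .prod F G, _, _, M => Matrix.fromBlocks (F.mat M) 0 0 (G.mat M)
  | .tensor F G, _, _, M => fun a b => F.mat M a.1 b.1 * G.mat M a.2 b.2
  | .sym _ F, _, _, M => fun a b => ∏ i, F.mat M (a i) (b i)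

theorem mat_mulVec_mem (F : Construction) {m n : ℕ} (M : Matrix (Fin m) (Fin n) ℝ)
    {x : F.Idx n → ℝ} (hx : x ∈ F.coords n) : (F.mat M).mulVec x ∈ F.coords m := by
  induction F with
  | id => exact Submodule.mem_top
  | prod F G ihF ihG =>
    have h : Matrix.mulVec (mat (.prod F G) M) x = Sum.elim
        (Matrix.mulVec (F.mat M) (fun i => x (Sum.inl i)))
        (Matrix.mulVec (G.mat M) (fun i => x (Sum.inr i))) := by
      refine (Matrix.fromBlocks_mulVec _ _ _ _ _).trans ?_
      simp only [Matrix.zero_mulVec, add_zero, zero_add]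
      rfl
    rw [h]
    exact ⟨ihF hx.1, ihG hx.2⟩
  | tensor F G ihF ihG =>
    change _ ∈ Submodule.comap (Matrix.mulVecLin (mat (.tensor F G) M)) (coords (.tensor F G) m)
    revert x
    change coords (.tensor F G) n ≤ _
    refine Submodule.span_le.2 ?_
    rintro _ ⟨v, hv, w, hw, rfl⟩
    refine Submodule.subset_span ⟨_, ihF hv, _, ihG hw, ?_⟩
    funext a
    exact (Fintype.sum_prod_type _).trans (by
      simp only [Matrix.mulVec, dotProduct, Finset.sum_mul_sum, mat]
      exact Finset.sum_congr rfl fun i _ => Finset.sum_congr rfl fun j _ => by ring)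
  | sym k F ih =>
    obtain ⟨h1, h2⟩ := hx
    constructor
    · refine (Submodule.span_le (p := Submodule.comap
        (Matrix.mulVecLin (mat (.sym k F) M)) (Submodule.span ℝ _))).2 ?_ h1
      rintro _ ⟨v, hv, rfl⟩
      refine Submodule.subset_span ⟨fun i => (F.mat M).mulVec (v i), fun i => ih (hv i), ?_⟩
      funext a
      simp only [Matrix.mulVec, dotProduct, Finset.prod_univ_sum, Fintype.piFinset_univ]
      exact Finset.sum_congr rfl fun b _ => Finset.prod_mul_distrib.symm
    · refine (Submodule.mem_iInf _).2 fun σ => ?_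
      have hσ := (Submodule.mem_iInf _).1 h2 σ
      replace hσ : ∀ b : Fin k → F.Idx n, x (b ∘ σ) = x b := fun b => congrFun hσ b
      refine funext fun a : Fin k → F.Idx m => ?_
      change ∑ b : Fin k → F.Idx n, (∏ i, F.mat M (a (σ i)) (b i)) * x b =
        ∑ b : Fin k → F.Idx n, (∏ i, F.mat M (a i) (b i)) * x b
      refine ((Equiv.arrowCongr σ.symm (Equiv.refl (F.Idx n))).sum_comp
        (fun b => (∏ i, F.mat M (a (σ i)) (b i)) * x b)).symm.trans ?_
      refine Finset.sum_congr rfl fun b _ => ?_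
      change (∏ i, F.mat M (a (σ i)) (b (σ i))) * x (b ∘ σ) = _
      rw [hσ, Equiv.prod_comp σ (fun i => F.mat M (a i) (b i))]

/-- `F(ℝⁿ)` with the inner product extended from the standard one on `ℝⁿ` (the Frobenius inner
product on tensors). -/
def V (F : Construction) (n : ℕ) : Submodule ℝ (EuclideanSpace ℝ (F.Idx n)) :=
  (F.coords n).comap (WithLp.linearEquiv 2 ℝ (F.Idx n → ℝ)).toLinearMap

/-- The linear map `F(M) : F(ℝⁿ) → F(ℝᵐ)`. -/
def map (F : Construction) {m n : ℕ} (M : Matrix (Fin m) (Fin n) ℝ) : F.V n →ₗ[ℝ] F.V m :=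
  LinearMap.restrict
    ((WithLp.linearEquiv 2 ℝ (F.Idx m → ℝ)).symm.toLinearMap ∘ₗ (F.mat M).mulVecLin ∘ₗ
      (WithLp.linearEquiv 2 ℝ (F.Idx n → ℝ)).toLinearMap)
    (fun _ hx => F.mat_mulVec_mem M hx)

/-- For `f : [m] → [n]`, the linear map `ρ(f) : F(ℝⁿ) → F(ℝᵐ)` induced by
`ℝⁿ → ℝᵐ`, `(ρ(f) x) i = x (f i)`. -/
def rho (F : Construction) {m n : ℕ} (f : Fin m → Fin n) : F.V n →ₗ[ℝ] F.V m :=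
  F.map (fun i j => if f i = j then 1 else 0)

/-- The action of the symmetric group on `F(ℝⁿ)`, induced by `(g • x) i = x (g⁻¹ i)` on `ℝⁿ`. -/
def act (F : Construction) {n : ℕ} (g : Equiv.Perm (Fin n)) : F.V n →ₗ[ℝ] F.V n :=
  F.rho (g⁻¹ : Equiv.Perm (Fin n))

/-- The `ℓ¹` norm with respect to the extended basis. -/
def norm1 (F : Construction) {n : ℕ} (x : F.V n) : ℝ :=
  ∑ a : F.Idx n, |(x : EuclideanSpace ℝ (F.Idx n)) a|

/-- The norm of a linear functional on `F(ℝⁿ)` that is dual to the `ℓ¹` norm. -/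
def dualNorm (F : Construction) {n : ℕ} (φ : F.V n →L[ℝ] ℝ) : ℝ :=
  sSup {r : ℝ | ∃ v : F.V n, F.norm1 v ≤ 1 ∧ r = |φ v|}

end Construction

/-! ## The base sequences and the pairs derived from them -/

/-- The two base sequences on `(ℝⁿ)`, `n ≥ 1`: zero-padding `Z` and duplication `D`. -/
inductive BaseSeq : Type
  | Z : BaseSeq
  | D : BaseSeq

namespace BaseSeq

/-- The other base sequence. -/
def opp : BaseSeq → BaseSeq
  | .Z => .D
  | .D => .Z

/-- The order on dimensions: `≤` for zero-padding and divisibility for duplication. -/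
def Prec : BaseSeq → ℕ+ → ℕ+ → Prop
  | .Z, n, N => n ≤ N
  | .D, n, N => (n : ℕ) ∣ (N : ℕ)

/-- The matrix of the embedding `ℝⁿ → ℝᴺ`: `x ↦ (x, 0)` for zero-padding, and
`x ↦ (x₁, …, x₁, …, xₙ, …, xₙ)`, each entry repeated `N / n` times, for duplication. It is used
only if `n` precedes `N`. -/
def embedMat : BaseSeq → (n N : ℕ+) → Matrix (Fin N) (Fin n) ℝ
  | .Z, _, _ => fun i j => if (i : ℕ) = (j : ℕ) then 1 else 0
  | .D, n, N => fun i j => if (i : ℕ) / ((N : ℕ) / (n : ℕ)) = (j : ℕ) then 1 else 0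

end BaseSeq

/-- The embedding `F(ℝⁿ) → F(ℝᴺ)` of the sequence `F(B)`. -/
def emb (F : Construction) (B : BaseSeq) (n N : ℕ+) : F.V n →ₗ[ℝ] F.V N :=
  F.map (B.embedMat n N)

/-- The projection `F(ℝᴺ) → F(ℝⁿ)` of the sequence `F(B)`, the adjoint of the embedding. -/
def proj (F : Construction) (B : BaseSeq) (n N : ℕ+) : F.V N →ₗ[ℝ] F.V n :=
  LinearMap.adjoint (emb F B n N)

/-- Compatibility of sets `Ω n ⊆ F(ℝⁿ)` with the pair `(F(U), F(U.opp))`: they are invariant under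
permutations, embed into each other in `F(U)`, and project into each other in `F(U.opp)`. -/
structure FSCompatible (F : Construction) (U : BaseSeq) (Ω : ∀ n : ℕ+, Set (F.V n)) : Prop where
  invariant : ∀ (n : ℕ+) (g : Equiv.Perm (Fin n)), ∀ x ∈ Ω n, F.act g x ∈ Ω n
  embeds : ∀ n N : ℕ+, U.Prec n N → ∀ x ∈ Ω n, emb F U n N x ∈ Ω N
  projects : ∀ n N : ℕ+, U.opp.Prec n N → ∀ x ∈ Ω N, proj F U.opp n N x ∈ Ω n

/-! ## Polynomials -/

/-- `p` is a polynomial function of degree at most `d` on `F(ℝⁿ)`. -/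
def IsPolynomial (F : Construction) {n : ℕ} (d : ℕ) (p : F.V n → ℝ) : Prop :=
  ∃ P : MvPolynomial (F.Idx n) ℝ, P.totalDegree ≤ d ∧
    ∀ x : F.V n, p x = MvPolynomial.eval (fun a => (x : EuclideanSpace ℝ (F.Idx n)) a) P

/-- `p` is invariant under permutations. -/
def IsInvariant (F : Construction) {n : ℕ} (p : F.V n → ℝ) : Prop :=
  ∀ (g : Equiv.Perm (Fin n)) (x : F.V n), p (F.act g x) = p x

/-- `(p n)` is a freely-described sequence of polynomials of degree at most `d` over `F(U)`. -/
structure FreelyDescribed (F : Construction) (U : BaseSeq) (d : ℕ)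
    (p : ∀ n : ℕ+, F.V n → ℝ) : Prop where
  polynomial : ∀ n : ℕ+, IsPolynomial F d (p n)
  invariant : ∀ n : ℕ+, IsInvariant F (p n)
  compatible : ∀ n N : ℕ+, U.Prec n N → ∀ x : F.V n, p N (emb F U n N x) = p n x

/-- The polynomial `sym_n q` of the sequence `F(B)`: the average over the symmetric group of the
composition of `q` with the projection `F(ℝⁿ) → F(ℝᵏ)`. -/
def symTo (F : Construction) (B : BaseSeq) {k : ℕ+} (n : ℕ+) (q : F.V k → ℝ) (x : F.V n) : ℝ :=
  (∑ g : Equiv.Perm (Fin n), q (proj F B k n (F.act g⁻¹ x))) / (n : ℕ).factorial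

/-- The expectation of `q (L x)` for the random de Finetti map `L : F(ℝⁿ) → F(ℝᵏ)` of the pair
`(F(U), F(U.opp))`. If `U = D`, then `L = ρ(f)` with `f : [k] → [n]` uniformly random; if `U = Z`,
then `L` is the adjoint of `ρ(f)` with `f : [n] → [k]` uniformly random. -/
def deFinettiMean (F : Construction) (U : BaseSeq) {k n : ℕ+} (q : F.V k → ℝ) (x : F.V n) : ℝ :=
  match U with
  | .D => (∑ f : Fin k → Fin n, q (F.rho f x)) / Fintype.card (Fin k → Fin n)
  | .Z => (∑ f : Fin n → Fin k, q (LinearMap.adjoint (F.rho f) x)) / Fintype.card (Fin n → Fin k)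

/-- `q` is a polynomial on `F(ℝᵏ)` with `p n x = 𝔼 [q (L x)]` for all `n` and all `x`, where `L` is
the random de Finetti map. -/
def IsDualCost (F : Construction) (U : BaseSeq) (p : ∀ n : ℕ+, F.V n → ℝ) {k : ℕ+}
    (q : F.V k → ℝ) : Prop :=
  (∃ d, IsPolynomial F d q) ∧ ∀ (n : ℕ+) (x : F.V n), p n x = deFinettiMean F U q x

/-! ## Freely-described measures -/

/-- `(μ n)` is a freely-described sequence of probability measures over `F(B)` supported on the
(closed) sets `(Ω n)`: each is invariant under permutations, and they project onto each other. -/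
structure FreelyDescribedMeasure (F : Construction) (B : BaseSeq) (Ω : ∀ n : ℕ+, Set (F.V n))
    (μ : ∀ n : ℕ+, Measure (F.V n)) : Prop where
  prob : ∀ n : ℕ+, IsProbabilityMeasure (μ n)
  support : ∀ n : ℕ+, ∀ᵐ x ∂μ n, x ∈ Ω n
  invariant : ∀ (n : ℕ+) (g : Equiv.Perm (Fin n)), (μ n).map (F.act g) = μ n
  projects : ∀ n N : ℕ+, B.Prec n N → (μ N).map (proj F B n N) = μ n

/-! ## Optimal values and norms -/

/-- The optimal value `inf_{x ∈ S} p x`. -/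
def optVal {X : Type*} (S : Set X) (p : X → ℝ) : ℝ := sInf (p '' S)

/-- The supremum norm `sup_{x ∈ S} |q x|`. -/
def supNorm {X : Type*} (S : Set X) (q : X → ℝ) : ℝ := sSup ((fun x => |q x|) '' S)

/-- The supremum over `S` of the dual norm of the derivative of `q`. -/
def gradNorm (F : Construction) {n : ℕ} (S : Set (F.V n)) (q : F.V n → ℝ) : ℝ :=
  sSup ((fun x => F.dualNorm (fderiv ℝ q x)) '' S)

end FSPair

end

/-! Everything is governed by maps between finite sets. A map `f : [m] → [n]` relabels the indices
of extended coordinates; `F.rho f` pulls coordinates back along the relabelling, and its adjoint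
`F.push f` sums them over fibres. Embeddings, projections, permutations and all samples of the de
Finetti maps `L` have one of these two forms, so composing them means composing functions. Maps with
fibres of equal size carry uniform samples to uniform samples, so in law `L` is compatible with the
embeddings of `U`, the projections of `U.opp` and the symmetric group. Every `f` is an inclusion
followed by a permutation and a block map, so `L` sends `Ω n` into `Ω k`
(`FSCompatible.sampleMap_mem`).

Dual cost: an invariant polynomial is a combination of orbit sums of monomials. The index of a
monomial involves at most `d * F.deg` base coordinates, and induction on their number writes its
orbit sum as a sampling mean from one fixed dimension `K` (`exists_coeff_restrict`,
`exists_coeff_push`). Conversely, an invariant function on `F.V K` is determined by its sampling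
means in dimensions at most `K` (`eq_of_forall_sample_mean_eq`). Hence the polynomials representing
`p N` stabilise in `N`, and one `q` serves all dimensions. Since `symTo` preserves sampling means,
the same principle gives uniqueness and the tower property of symmetrization.

Bounds: `p m x` averages `symTo q` over points of `Ω n`, so each lower bound is below every optimal
value. The laws of `L x` form a freely-described measure, and against any such measure `q`
integrates to at least each lower bound. Convergence thus follows from the rates, and the
reformulation from convergence.

Rates: for `U = D`, `p n - symTo q` compares sampling with and without replacement. For `U = Z` it
compares uniform maps `[n] → [k]` with balanced ones; `exists_balanced_coupling` changes each
position with probability `O(n^(-1/2))`, and the mean value theorem gives the explicit bound. The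
`ℓ¹` norm there may grow with `n`, so the uniform constant comes from elsewhere: monomial by
monomial, the difference is an invariant combination with weights `O(n^(-1/2))`, which
`exists_coeff_push` turns into an average, over points of a fixed compact `Ω K`, of polynomials with
coefficients of that size. -/

open scoped BigOperators

noncomputable section

namespace FSPair

/-! ### Calculus of indices: pullback and push-forward along maps of finite sets -/

namespace Construction

instance (F : Construction) (n : ℕ) : DecidableEq (F.Idx n) := Classical.decEq _

/-- The map on indices of extended coordinates induced by a map `f : [m] → [n]`. -/
def relabel : (F : Construction) → {m n : ℕ} → (Fin m → Fin n) → F.Idx m → F.Idx n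
  | .id, _, _, f => f
  | .prod F G, _, _, f => Sum.map (F.relabel f) (G.relabel f)
  | .tensor F G, _, _, f => Prod.map (F.relabel f) (G.relabel f)
  | .sym _ F, _, _, f => fun a i => F.relabel f (a i)

/-- The set of elements of `[n]` occurring in the index of an extended coordinate. -/
def support : (F : Construction) → {n : ℕ} → F.Idx n → Finset (Fin n)
  | .id, _, i => {i}
  | .prod F G, _, a => Sum.elim F.support G.support a
  | .tensor F G, _, a => F.support a.1 ∪ G.support a.2
  | .sym _ F, _, a => Finset.univ.biUnion fun i => F.support (a i)

theorem relabel_congr (F : Construction) {m n : ℕ} {f g : Fin m → Fin n} {a : F.Idx m}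
    (h : ∀ i ∈ F.support a, f i = g i) : F.relabel f a = F.relabel g a := by
  induction F with
  | id => exact h a (Finset.mem_singleton_self _)
  | prod F G ihF ihG =>
    rcases a with a | a
    · exact congrArg Sum.inl (ihF h)
    · exact congrArg Sum.inr (ihG h)
  | tensor F G ihF ihG =>
    exact Prod.ext (ihF fun i hi => h i (Finset.mem_union_left _ hi))
      (ihG fun i hi => h i (Finset.mem_union_right _ hi))
  | sym k F ih =>
    exact funext fun j => ih fun i hi =>
      h i (Finset.mem_biUnion.2 ⟨j, Finset.mem_univ _, hi⟩)

theorem relabel_id (F : Construction) {n : ℕ} (a : F.Idx n) : F.relabel _root_.id a = a := by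
  induction F with
  | id => rfl
  | prod F G ihF ihG =>
    rcases a with a | a
    · exact congrArg Sum.inl (ihF a)
    · exact congrArg Sum.inr (ihG a)
  | tensor F G ihF ihG => exact Prod.ext (ihF _) (ihG _)
  | sym k F ih => exact funext fun j => ih _

theorem relabel_relabel (F : Construction) {l m n : ℕ} (f : Fin m → Fin n) (g : Fin l → Fin m)
    (a : F.Idx l) : F.relabel f (F.relabel g a) = F.relabel (f ∘ g) a := by
  induction F with
  | id => rfl
  | prod F G ihF ihG =>
    rcases a with a | a
    · exact congrArg Sum.inl (ihF a)
    · exact congrArg Sum.inr (ihG a)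
  | tensor F G ihF ihG => exact Prod.ext (ihF _) (ihG _)
  | sym k F ih => exact funext fun j => ih _

theorem support_relabel (F : Construction) {m n : ℕ} (f : Fin m → Fin n) (a : F.Idx m) :
    F.support (F.relabel f a) = (F.support a).image f := by
  induction F with
  | id => exact (Finset.image_singleton (f : Fin m → Fin n) (a : Fin m)).symm
  | prod F G ihF ihG =>
    rcases a with a | a
    · exact ihF a
    · exact ihG a
  | tensor F G ihF ihG =>
    change F.support (F.relabel f a.1) ∪ G.support (G.relabel f a.2) =
      (F.support a.1 ∪ G.support a.2).image f
    rw [ihF, ihG, Finset.image_union]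
  | sym k F ih =>
    change (Finset.univ.biUnion fun i => F.support (F.relabel f (a i))) =
      (Finset.univ.biUnion fun i => F.support (a i)).image f
    simp only [ih, Finset.biUnion_image]

/-- The degree enters the proof only through this bound: it fixes the dimension needed for dual
costs and the factor `F.deg` in the second rate. -/
theorem card_support_le (F : Construction) {n : ℕ} (a : F.Idx n) :
    (F.support a).card ≤ F.deg := by
  induction F with
  | id => exact (Finset.card_singleton _).le
  | prod F G ihF ihG =>
    rcases a with a | a
    · exact (ihF a).trans (le_max_left _ _)
    · exact (ihG a).trans (le_max_right _ _)
  | tensor F G ihF ihG =>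
    exact (Finset.card_union_le _ _).trans (add_le_add (ihF _) (ihG _))
  | sym k F ih =>
    refine (Finset.card_biUnion_le_card_mul _ _ F.deg fun i _ => ih _).trans ?_
    simp [deg]

theorem relabel_bijective (F : Construction) {n : ℕ} (g : Equiv.Perm (Fin n)) :
    Function.Bijective (F.relabel g : F.Idx n → F.Idx n) := by
  refine Function.bijective_iff_has_inverse.2 ⟨F.relabel g.symm, fun a => ?_, fun a => ?_⟩
  · rw [relabel_relabel, Equiv.symm_comp_self, relabel_id]
  · rw [relabel_relabel, Equiv.self_comp_symm, relabel_id]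

/-- The matrix of `ρ(f)` on `ℝⁿ`. -/
def relMat {m n : ℕ} (f : Fin m → Fin n) : Matrix (Fin m) (Fin n) ℝ :=
  fun i j => if f i = j then 1 else 0

theorem rho_eq_map (F : Construction) {m n : ℕ} (f : Fin m → Fin n) :
    F.rho f = F.map (relMat f) := rfl

/-- Direct sums and Kronecker products of matrices that select one coordinate per row are again of
this kind. This replaces multilinear algebra by combinatorics of indices. -/
theorem mat_relMat (F : Construction) {m n : ℕ} (f : Fin m → Fin n) (a : F.Idx m) (b : F.Idx n) :
    F.mat (relMat f) a b = if F.relabel f a = b then 1 else 0 := by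
  have key : (F.relabel f a = b → F.mat (relMat f) a b = 1) ∧
      (F.relabel f a ≠ b → F.mat (relMat f) a b = 0) := by
    induction F with
    | id => exact ⟨fun h => if_pos h, fun h => if_neg h⟩
    | prod F G ihF ihG =>
      rcases a with a | a <;> rcases b with b | b
      · exact ⟨fun h => (ihF a b).1 (Sum.inl_injective h),
          fun h => (ihF a b).2 fun h' => h (congrArg Sum.inl h')⟩
      · exact ⟨fun h => (Sum.inl_ne_inr h).elim, fun _ => rfl⟩
      · exact ⟨fun h => (Sum.inr_ne_inl h).elim, fun _ => rfl⟩
      · exact ⟨fun h => (ihG a b).1 (Sum.inr_injective h),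
          fun h => (ihG a b).2 fun h' => h (congrArg Sum.inr h')⟩
    | tensor F G ihF ihG =>
      change (_ → F.mat _ a.1 b.1 * G.mat _ a.2 b.2 = 1) ∧
        (_ → F.mat _ a.1 b.1 * G.mat _ a.2 b.2 = 0)
      constructor
      · rintro rfl
        exact (congrArg₂ (· * ·) ((ihF a.1 _).1 rfl) ((ihG a.2 _).1 rfl)).trans (one_mul 1)
      · intro h
        by_cases h1 : F.relabel f a.1 = b.1
        · rw [(ihG a.2 b.2).2 fun h2 => h (Prod.ext h1 h2), mul_zero]
        · rw [(ihF a.1 b.1).2 h1, zero_mul]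
    | sym k F ih =>
      change (_ → ∏ i, F.mat _ (a i) (b i) = 1) ∧ (_ → ∏ i, F.mat _ (a i) (b i) = 0)
      constructor
      · rintro rfl
        exact Finset.prod_eq_one fun i _ => (ih _ _).1 rfl
      · intro h
        obtain ⟨i, hi⟩ := Function.ne_iff.1 h
        exact Finset.prod_eq_zero (Finset.mem_univ i) ((ih _ _).2 hi)
  split_ifs with h
  exacts [key.1 h, key.2 h]

theorem mat_transpose (F : Construction) {m n : ℕ} (M : Matrix (Fin m) (Fin n) ℝ)
    (a : F.Idx m) (b : F.Idx n) : F.mat M.transpose b a = F.mat M a b := by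
  induction F with
  | id => rfl
  | prod F G ihF ihG =>
    rcases a with a | a <;> rcases b with b | b
    · exact ihF a b
    · rfl
    · rfl
    · exact ihG a b
  | tensor F G ihF ihG => exact congrArg₂ _ (ihF _ _) (ihG _ _)
  | sym k F ih => exact Finset.prod_congr rfl fun i _ => ih _ _

theorem map_apply (F : Construction) {m n : ℕ} (M : Matrix (Fin m) (Fin n) ℝ) (x : F.V n)
    (a : F.Idx m) : (F.map M x).1 a = ∑ b, F.mat M a b * x.1 b := rfl

theorem adjoint_map (F : Construction) {m n : ℕ} (M : Matrix (Fin m) (Fin n) ℝ) :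
    LinearMap.adjoint (F.map M) = F.map M.transpose := by
  symm
  rw [LinearMap.eq_adjoint_iff]
  intro x y
  simp only [Submodule.coe_inner, PiLp.inner_apply, map_apply, RCLike.inner_apply,
    conj_trivial, mat_transpose, Finset.mul_sum, Finset.sum_mul]
  rw [Finset.sum_comm]
  exact Finset.sum_congr rfl fun i _ => Finset.sum_congr rfl fun j _ => by ring

theorem rho_apply (F : Construction) {m n : ℕ} (f : Fin m → Fin n) (x : F.V n) (a : F.Idx m) :
    (F.rho f x).1 a = x.1 (F.relabel f a) := by
  simp only [rho_eq_map, map_apply, mat_relMat, ite_mul, one_mul, zero_mul, Finset.sum_ite_eq,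
    Finset.mem_univ, if_true]

theorem V_ext (F : Construction) {n : ℕ} {x y : F.V n} (h : ∀ a, x.1 a = y.1 a) : x = y :=
  Subtype.ext (PiLp.ext h)

theorem rho_rho (F : Construction) {l m n : ℕ} (f : Fin l → Fin m) (g : Fin m → Fin n)
    (x : F.V n) : F.rho f (F.rho g x) = F.rho (g ∘ f) x :=
  F.V_ext fun a => by simp only [rho_apply, relabel_relabel]

theorem rho_id (F : Construction) {n : ℕ} (x : F.V n) : F.rho _root_.id x = x :=
  F.V_ext fun a => by simp only [rho_apply, relabel_id]

/-- The adjoint of `ρ(f)`, which sums the coordinates over the fibres of `f`. -/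
def push (F : Construction) {m n : ℕ} (f : Fin m → Fin n) : F.V m →ₗ[ℝ] F.V n :=
  LinearMap.adjoint (F.rho f)

theorem push_apply (F : Construction) {m n : ℕ} (f : Fin m → Fin n) (x : F.V m) (b : F.Idx n) :
    (F.push f x).1 b = ∑ a, if F.relabel f a = b then x.1 a else 0 := by
  rw [push, rho_eq_map, adjoint_map, map_apply]
  simp only [mat_transpose, mat_relMat, ite_mul, one_mul, zero_mul]

theorem push_push (F : Construction) {l m n : ℕ} (f : Fin m → Fin n) (g : Fin l → Fin m)
    (x : F.V l) : F.push f (F.push g x) = F.push (f ∘ g) x := by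
  have h : F.rho (f ∘ g) = F.rho g ∘ₗ F.rho f :=
    LinearMap.ext fun x => (F.rho_rho g f x).symm
  rw [push, push, push, h, LinearMap.adjoint_comp]
  rfl

/-- Permutation matrices are orthogonal. The action can therefore be absorbed into either calculus,
as a push-forward along `g` or as a pullback along `g⁻¹`. -/
theorem push_perm (F : Construction) {n : ℕ} (g : Equiv.Perm (Fin n)) :
    F.push g = F.act g := by
  refine LinearMap.ext fun x => F.V_ext fun b => ?_
  rw [push_apply, act, rho_apply]
  have h : ∀ a, F.relabel g a = b ↔ a = F.relabel (g⁻¹ : Equiv.Perm (Fin n)) b := by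
    intro a
    constructor
    · rintro rfl
      rw [relabel_relabel]
      exact ((congrArg (F.relabel · a) (Equiv.symm_comp_self g)).trans (F.relabel_id a)).symm
    · rintro rfl
      rw [relabel_relabel]
      exact (congrArg (F.relabel · b) (Equiv.self_comp_symm g)).trans (F.relabel_id b)
  simp only [h, Finset.sum_ite_eq', Finset.mem_univ, if_true]

theorem push_id (F : Construction) {n : ℕ} (x : F.V n) : F.push _root_.id x = x := by
  exact (LinearMap.congr_fun (F.push_perm (1 : Equiv.Perm (Fin n))) x).trans (F.rho_id x)

theorem rho_perm (F : Construction) {n : ℕ} (g : Equiv.Perm (Fin n)) (x : F.V n) :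
    F.rho g x = F.act g⁻¹ x := by
  rw [act, inv_inv]

end Construction

/-- The block map `[N] → [n]`, `i ↦ ⌊i / (N / n)⌋`, for `n` dividing `N`. -/
def blk {n N : ℕ+} (h : (n : ℕ) ∣ N) (i : Fin N) : Fin n :=
  ⟨(i : ℕ) / ((N : ℕ) / n), by
    rw [Nat.div_lt_iff_lt_mul (Nat.div_pos (Nat.le_of_dvd N.pos h) n.pos),
      Nat.mul_div_cancel' h]
    exact i.2⟩

/-- With the next three identities, all structure maps of both sequences come from just two
functions, the block map and the initial inclusion; taking adjoints exchanges `rho` and `push`. -/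
theorem emb_D (F : Construction) {n N : ℕ+} (h : (n : ℕ) ∣ N) :
    emb F .D n N = F.rho (blk h) := by
  unfold emb Construction.rho
  congr 1
  funext i j
  exact if_congr (by rw [Fin.ext_iff]; rfl) rfl rfl

theorem emb_Z (F : Construction) {n N : ℕ+} (h : (n : ℕ) ≤ N) :
    emb F .Z n N = F.push (Fin.castLE h) := by
  rw [Construction.push, Construction.rho_eq_map, Construction.adjoint_map]
  unfold emb
  congr 1
  funext i j
  exact if_congr (by rw [Fin.ext_iff]; exact eq_comm) rfl rfl

theorem proj_D (F : Construction) {n N : ℕ+} (h : (n : ℕ) ∣ N) :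
    proj F .D n N = F.push (blk h) := by
  rw [proj, emb_D F h]
  rfl

theorem proj_Z (F : Construction) {n N : ℕ+} (h : (n : ℕ) ≤ N) :
    proj F .Z n N = F.rho (Fin.castLE h) := by
  rw [proj, emb_Z F h, Construction.push, LinearMap.adjoint_adjoint]

/-! ## Averages and maps with uniform fibres -/

/-- All fibres of `π` have the same cardinality. -/
def UniformFibers {A B : Type*} [Fintype A] [DecidableEq B] (π : A → B) : Prop :=
  ∃ c : ℕ, ∀ b, (Finset.univ.filter fun a => π a = b).card = c

/-- Values lie in an arbitrary additive monoid because this is applied to natural numbers (for the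
cardinality), to reals, and to Dirac measures. -/
theorem UniformFibers.exists_sum_comp {A B : Type*} [Fintype A] [Fintype B] [DecidableEq B]
    {π : A → B} (h : UniformFibers π) : ∃ c : ℕ, Fintype.card A = c * Fintype.card B ∧
      ∀ {M : Type} [AddCommMonoid M] (φ : B → M), ∑ a, φ (π a) = c • ∑ b, φ b := by
  obtain ⟨c, hc⟩ := h
  have key : ∀ {M : Type} [AddCommMonoid M] (φ : B → M), ∑ a, φ (π a) = c • ∑ b, φ b := by
    intro M _ φ
    rw [← Finset.sum_fiberwise Finset.univ π, Finset.smul_sum]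
    refine Finset.sum_congr rfl fun b _ => ?_
    rw [← hc b, Finset.sum_congr rfl (g := fun _ => φ b), Finset.sum_const]
    intro a ha
    rw [(Finset.mem_filter.1 ha).2]
  refine ⟨c, ?_, key⟩
  simpa using key (M := ℕ) (fun _ => 1)

theorem UniformFibers.expect_comp {A B : Type*} [Fintype A] [Fintype B] [DecidableEq B]
    [Nonempty A] {π : A → B} (h : UniformFibers π) (φ : B → ℝ) :
    𝔼 a, φ (π a) = 𝔼 b, φ b := by
  obtain ⟨c, hc, hsum⟩ := h.exists_sum_comp
  have hA : (Fintype.card A : ℝ) ≠ 0 := Nat.cast_ne_zero.2 Fintype.card_ne_zero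
  rw [Fintype.expect_eq_sum_div_card, Fintype.expect_eq_sum_div_card, hsum φ]
  rw [hc, Nat.cast_mul] at hA ⊢
  rw [nsmul_eq_mul, mul_div_mul_left _ _ (left_ne_zero_of_mul hA)]

theorem uniformFibers_of_bijective {A B : Type*} [Fintype A] [DecidableEq B] {π : A → B}
    (h : Function.Bijective π) : UniformFibers π := by
  refine ⟨1, fun b => Finset.card_eq_one.2 ?_⟩
  obtain ⟨a, rfl⟩ := h.2 b
  exact ⟨a, by ext x; simp [h.1.eq_iff]⟩

/-- The values of a uniform map are independent: a fibre is a box with one choice at each point of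
the range of `ι` and `n` choices elsewhere. -/
theorem uniformFibers_restrict {k n N : ℕ} {ι : Fin k → Fin N} (hι : Function.Injective ι) :
    UniformFibers (fun f : Fin N → Fin n => f ∘ ι) := by
  classical
  refine ⟨∏ i : Fin N, if i ∈ Set.range ι then 1 else n, fun g => ?_⟩
  have h : (Finset.univ.filter fun f : Fin N → Fin n => f ∘ ι = g) =
      Fintype.piFinset fun i => if h : i ∈ Set.range ι then {g h.choose} else Finset.univ := by
    ext f
    simp only [Finset.mem_filter, Finset.mem_univ, true_and, Fintype.mem_piFinset]
    constructor
    · rintro rfl i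
      split_ifs with h
      · rw [Finset.mem_singleton, Function.comp_apply, h.choose_spec]
      · exact Finset.mem_univ _
    · intro h
      funext j
      have h1 := h (ι j)
      rw [dif_pos ⟨j, rfl⟩, Finset.mem_singleton] at h1
      rw [Function.comp_apply, h1]
      exact congrArg g (hι (Exists.choose_spec (⟨j, rfl⟩ : ι j ∈ Set.range ι)))
  rw [h, Fintype.card_piFinset]
  refine Finset.prod_congr rfl fun i _ => ?_
  split_ifs <;> simp

theorem uniformFibers_comp {m n k : ℕ} {β : Fin n → Fin k} (hβ : UniformFibers β) :
    UniformFibers (fun f : Fin m → Fin n => β ∘ f) := by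
  obtain ⟨c, hc⟩ := hβ
  refine ⟨c ^ m, fun g => ?_⟩
  have h : (Finset.univ.filter fun f : Fin m → Fin n => β ∘ f = g) =
      Fintype.piFinset fun i => Finset.univ.filter fun j => β j = g i := by
    ext f
    simp [funext_iff]
  rw [h, Fintype.card_piFinset]
  simp [hc]

theorem uniformFibers_blk {n N : ℕ+} (h : (n : ℕ) ∣ N) : UniformFibers (blk h) := by
  refine ⟨(N : ℕ) / n, fun b => ?_⟩
  have hpos : 0 < (N : ℕ) / n := Nat.div_pos (Nat.le_of_dvd N.pos h) n.pos
  have hb : ((b : ℕ) + 1) * ((N : ℕ) / n) ≤ N := by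
    calc ((b : ℕ) + 1) * ((N : ℕ) / n) ≤ n * ((N : ℕ) / n) := Nat.mul_le_mul_right _ b.2
      _ = N := Nat.mul_div_cancel' h
  have e : (Finset.univ.filter fun i => blk h i = b).map Fin.valEmbedding =
      Finset.Ico ((b : ℕ) * ((N : ℕ) / n)) (((b : ℕ) + 1) * ((N : ℕ) / n)) := by
    ext i
    simp only [Finset.mem_map, Finset.mem_filter, Finset.mem_univ, true_and,
      Fin.valEmbedding_apply, Finset.mem_Ico]
    constructor
    · rintro ⟨j, hj, rfl⟩
      rw [← hj]
      exact ⟨Nat.div_mul_le_self _ _, Nat.lt_mul_of_div_lt (Nat.lt_succ_self _) hpos⟩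
    · rintro ⟨h1, h2⟩
      refine ⟨⟨i, h2.trans_le hb⟩, Fin.ext ?_, rfl⟩
      exact Nat.div_eq_of_lt_le h1 h2
  rw [← Finset.card_map Fin.valEmbedding, e, Nat.card_Ico, ← Nat.sub_mul]
  simp

/-! ## Extension of partial injections to permutations -/

theorem exists_perm_extend {n : ℕ} {I : Finset (Fin n)} {f : Fin n → Fin n}
    (hf : Set.InjOn f I) : ∃ g : Equiv.Perm (Fin n), ∀ i ∈ I, g i = f i := by
  obtain ⟨g, hg⟩ := Finset.exists_equiv_extend_of_card_eq (t := (Finset.univ : Finset (Fin n)))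
    (by simp) (Finset.subset_univ _) hf
  exact ⟨g.trans (Equiv.subtypeUnivEquiv Finset.mem_univ), hg⟩

theorem exists_perm_comp_eq {m n : ℕ} {I : Finset (Fin m)} {f h : Fin m → Fin n}
    (hf : Set.InjOn f I) (hh : Set.InjOn h I) :
    ∃ g : Equiv.Perm (Fin n), ∀ i ∈ I, g (h i) = f i := by
  rcases I.eq_empty_or_nonempty with rfl | ⟨i₀, hi₀⟩
  · exact ⟨1, by simp⟩
  have : Nonempty (Fin m) := ⟨i₀⟩
  have hl := hh.leftInvOn_invFunOn
  obtain ⟨g, hg⟩ := exists_perm_extend (I := I.image h) (f := f ∘ Function.invFunOn h I) (by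
    intro x hx y hy hxy
    obtain ⟨i, hi, rfl⟩ := Finset.mem_image.1 (Finset.mem_coe.1 hx)
    obtain ⟨j, hj, rfl⟩ := Finset.mem_image.1 (Finset.mem_coe.1 hy)
    simp only [Function.comp_apply, hl hi, hl hj] at hxy
    rw [hf hi hj hxy])
  refine ⟨g, fun i hi => ?_⟩
  rw [hg _ (Finset.mem_image_of_mem _ hi), Function.comp_apply, hl hi]

/-- Every map `[a] → [b]` is a block map on `[b * a]` composed with a permutation and the
inclusion of `[a]`. -/
theorem exists_perm_blk_comp {a b N : ℕ+} (hN : N = b * a) (hb : (b : ℕ) ∣ N) (ha : (a : ℕ) ≤ N)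
    (f : Fin a → Fin b) :
    ∃ g : Equiv.Perm (Fin N), ∀ i, blk hb (g (Fin.castLE ha i)) = f i := by
  have hNba : (N : ℕ) = b * a := by rw [hN]; rfl
  -- Place `i` at position `i` of the block numbered `f i`. Blocks have length `a`, so the residue
  -- mod `a` recovers `i` and the placement is injective.
  have hlt : ∀ i : Fin a, (f i : ℕ) * a + i < N := fun i => by
    calc (f i : ℕ) * a + i < (f i : ℕ) * a + a := Nat.add_lt_add_left i.2 _
      _ = ((f i : ℕ) + 1) * a := by ring
      _ ≤ b * a := Nat.mul_le_mul_right _ (f i).2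
      _ = N := hNba.symm
  have hinj : Function.Injective fun i : Fin a => (⟨(f i : ℕ) * a + i, hlt i⟩ : Fin N) := by
    intro i j hij
    have h := congrArg (· % (a : ℕ)) (Fin.ext_iff.1 hij)
    simp only [Nat.mul_add_mod_self_right, Nat.mod_eq_of_lt i.2, Nat.mod_eq_of_lt j.2] at h
    exact Fin.ext h
  obtain ⟨g, hg⟩ := exists_perm_comp_eq (I := Finset.univ) (h := Fin.castLE ha)
    hinj.injOn (Fin.castLE_injective ha).injOn
  refine ⟨g, fun i => ?_⟩
  rw [hg i (Finset.mem_univ i)]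
  refine Fin.ext ?_
  change ((f i : ℕ) * a + i) / ((N : ℕ) / b) = f i
  rw [hNba, Nat.mul_div_cancel_left _ b.pos, mul_comm, Nat.mul_add_div a.pos,
    Nat.div_eq_of_lt i.2, add_zero]

/-! ## The samples underlying the de Finetti maps -/

/-- The set of maps from which the random map `L : F(ℝⁿ) → F(ℝᵏ)` is sampled. -/
def Sample : BaseSeq → ℕ → ℕ → Type
  | .Z, k, n => Fin n → Fin k
  | .D, k, n => Fin k → Fin n

instance : ∀ (U : BaseSeq) (k n : ℕ), Fintype (Sample U k n)
  | .Z, k, n => inferInstanceAs (Fintype (Fin n → Fin k))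
  | .D, k, n => inferInstanceAs (Fintype (Fin k → Fin n))

instance : ∀ (U : BaseSeq) (k n : ℕ), DecidableEq (Sample U k n)
  | .Z, k, n => inferInstanceAs (DecidableEq (Fin n → Fin k))
  | .D, k, n => inferInstanceAs (DecidableEq (Fin k → Fin n))

instance : ∀ (U : BaseSeq) (k n : ℕ+), Nonempty (Sample U k n)
  | .Z, k, n => inferInstanceAs (Nonempty (Fin n → Fin k))
  | .D, k, n => inferInstanceAs (Nonempty (Fin k → Fin n))

/-- The value of the random map `L : F(ℝⁿ) → F(ℝᵏ)` at a sample. -/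
def sampleMap (F : Construction) : (U : BaseSeq) → {k n : ℕ} → Sample U k n → F.V n →ₗ[ℝ] F.V k
  | .Z, _, _, f => F.push f
  | .D, _, _, f => F.rho f

theorem deFinettiMean_eq (F : Construction) (U : BaseSeq) {k n : ℕ+} (q : F.V k → ℝ)
    (x : F.V n) :
    deFinettiMean F U q x = 𝔼 f : Sample U k n, q (sampleMap F U f x) := by
  cases U
  · exact (Fintype.expect_eq_sum_div_card _).symm
  · exact (Fintype.expect_eq_sum_div_card _).symm

theorem symTo_eq (F : Construction) (B : BaseSeq) {k n : ℕ+} (q : F.V k → ℝ) (x : F.V n) :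
    symTo F B n q x = 𝔼 g : Equiv.Perm (Fin n), q (proj F B k n (F.act g⁻¹ x)) := by
  rw [Fintype.expect_eq_sum_div_card, Fintype.card_perm, Fintype.card_fin]
  rfl

/-- Here and in the next two lemmas, a structure map acts on samples by composition with a map with
uniform fibres on one side or with an injection on the other. Both operations preserve the uniform
distribution. -/
theorem exists_sample_proj (F : Construction) (U : BaseSeq) {k N n : ℕ+}
    (h : U.opp.Prec k N) : ∃ π : Sample U N n → Sample U k n, UniformFibers π ∧
      ∀ f x, proj F U.opp k N (sampleMap F U f x) = sampleMap F U (π f) x := by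
  cases U
  · refine ⟨fun f => blk h ∘ f, uniformFibers_comp (uniformFibers_blk h), fun f x => ?_⟩
    exact (LinearMap.congr_fun (proj_D F h) _).trans (F.push_push _ _ _)
  · refine ⟨fun f => f ∘ Fin.castLE h, uniformFibers_restrict (Fin.castLE_injective h),
      fun f x => ?_⟩
    exact (LinearMap.congr_fun (proj_Z F h) _).trans (F.rho_rho _ _ _)

theorem exists_sample_emb (F : Construction) (U : BaseSeq) {k N n : ℕ+}
    (h : U.Prec n N) : ∃ π : Sample U k N → Sample U k n, UniformFibers π ∧
      ∀ f x, sampleMap F U f (emb F U n N x) = sampleMap F U (π f) x := by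
  cases U
  · refine ⟨fun f => f ∘ Fin.castLE h, uniformFibers_restrict (Fin.castLE_injective h),
      fun f x => ?_⟩
    exact (congrArg (F.push f) (LinearMap.congr_fun (emb_Z F h) x)).trans (F.push_push _ _ _)
  · refine ⟨fun f => blk h ∘ f, uniformFibers_comp (uniformFibers_blk h), fun f x => ?_⟩
    exact (congrArg (F.rho f) (LinearMap.congr_fun (emb_D F h) x)).trans (F.rho_rho _ _ _)

theorem exists_sample_act (F : Construction) (U : BaseSeq) {k n : ℕ}
    (g : Equiv.Perm (Fin k)) : ∃ π : Sample U k n → Sample U k n, UniformFibers π ∧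
      ∀ f x, F.act g (sampleMap F U f x) = sampleMap F U (π f) x := by
  cases U
  · refine ⟨fun f => g ∘ f, uniformFibers_comp (uniformFibers_of_bijective g.bijective),
      fun f x => ?_⟩
    rw [← Construction.push_perm]
    exact F.push_push _ _ _
  · refine ⟨fun f => f ∘ (g⁻¹ : Equiv.Perm (Fin k)),
      uniformFibers_restrict (g⁻¹ : Equiv.Perm (Fin k)).injective, fun f x => ?_⟩
    exact F.rho_rho _ _ _

/-- Each single sample, and not just the average, is an embedding into the product dimension, a
permutation and a projection, and these are the three operations that FS-compatibility allows. -/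
theorem FSCompatible.sampleMap_mem {F : Construction} {U : BaseSeq} {Ω : ∀ n : ℕ+, Set (F.V n)}
    (hΩ : FSCompatible F U Ω) {k n : ℕ+} (f : Sample U k n) {x : F.V n} (hx : x ∈ Ω n) :
    sampleMap F U f x ∈ Ω k := by
  cases U
  · have hd : (k : ℕ) ∣ (k * n : ℕ+) := Dvd.intro _ rfl
    have hl : (n : ℕ) ≤ (k * n : ℕ+) := Nat.le_mul_of_pos_left _ k.pos
    obtain ⟨g, hg⟩ := exists_perm_blk_comp rfl hd hl f
    have e : sampleMap F .Z f x =
        proj F .D k (k * n) (F.act g (emb F .Z n (k * n) x)) := by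
      rw [proj_D F hd, emb_Z F hl, ← F.push_perm, F.push_push, F.push_push]
      exact congrArg (fun φ => F.push φ x) (funext fun i => (hg i).symm)
    rw [e]
    exact hΩ.projects _ _ hd _ (hΩ.invariant _ g _ (hΩ.embeds _ _ hl _ hx))
  · have hd : (n : ℕ) ∣ (n * k : ℕ+) := Dvd.intro _ rfl
    have hl : (k : ℕ) ≤ (n * k : ℕ+) := Nat.le_mul_of_pos_left _ n.pos
    obtain ⟨g, hg⟩ := exists_perm_blk_comp rfl hd hl f
    have e : sampleMap F .D f x =
        proj F .Z k (n * k) (F.act g⁻¹ (emb F .D n (n * k) x)) := by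
      rw [proj_Z F hl, emb_D F hd, ← F.rho_perm, F.rho_rho, F.rho_rho]
      exact congrArg (fun φ => F.rho φ x) (funext fun i => (hg i).symm)
    rw [e]
    exact hΩ.projects _ _ hl _ (hΩ.invariant _ g⁻¹ _ (hΩ.embeds _ _ hd _ hx))

/-! ## Invariant functions are determined by their sampling means -/

/-- Induction on `s` shows that `h` vanishes on push-forwards along injections `[s] → [k]`. In the
vanishing sum over all maps, a non-injective one factors through its smaller image and contributes
zero, while the injective ones contribute equal terms by invariance. The case `s = k` with the
identity is the claim. -/
theorem eq_zero_of_forall_sum_push {F : Construction} {k : ℕ+} {h : F.V k → ℝ}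
    (hinv : IsInvariant F h)
    (h0 : ∀ m : ℕ+, m ≤ k → ∀ x : F.V m, ∑ f : Fin m → Fin k, h (F.push f x) = 0)
    (x : F.V k) : h x = 0 := by
  have key : ∀ (s : ℕ) (hs : 0 < s) (y : F.V s) (φ : Fin s → Fin k), Function.Injective φ →
      h (F.push φ y) = 0 := by
    intro s
    induction s using Nat.strong_induction_on with
    | _ s ih =>
    intro hs y φ hφ
    have hsk : s ≤ k := by simpa using Fintype.card_le_of_injective φ hφ
    have hsum := h0 ⟨s, hs⟩ hsk y
    have hterm : ∀ f : Fin s → Fin k, h (F.push f y) =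
        if Function.Injective f then h (F.push φ y) else 0 := by
      intro f
      split_ifs with hf
      · obtain ⟨g, hg⟩ := exists_perm_comp_eq (I := Finset.univ) hf.injOn hφ.injOn
        rw [← hinv g (F.push φ y), ← F.push_perm, F.push_push]
        exact congrArg (fun ψ => h (F.push ψ y)) (funext fun i => (hg i (Finset.mem_univ i)).symm)
      · set T := Finset.univ.image f with hT
        have hTs : T.card < s := by
          refine lt_of_le_of_ne (by simpa using Finset.card_image_le (s := Finset.univ) (f := f))
            fun hc => hf ?_
          have := (Finset.card_image_iff (s := Finset.univ) (f := f)).1 (by simpa using hc)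
          exact Set.injOn_univ.1 (by simpa using this)
        have hT0 : 0 < T.card := Finset.card_pos.2 ⟨f ⟨0, hs⟩, by simp [hT]⟩
        have hmem : ∀ i, f i ∈ Set.range (T.orderEmbOfFin rfl) := by
          intro i
          rw [Finset.range_orderEmbOfFin]
          simp [hT]
        choose r hr using hmem
        have := ih _ hTs hT0 (F.push r y) (T.orderEmbOfFin rfl) (T.orderEmbOfFin rfl).injective
        rw [F.push_push] at this
        rw [← this]
        exact congrArg (fun ψ => h (F.push ψ y)) (funext fun i => (hr i).symm)
    have hsum' : ∑ f : Fin s → Fin k, h (F.push f y) = 0 := hsum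
    rw [Finset.sum_congr rfl fun f _ => hterm f, ← Finset.sum_filter, Finset.sum_const,
      smul_eq_zero, Finset.card_eq_zero] at hsum'
    rcases hsum' with h1 | h1
    · exact absurd (Finset.mem_filter.2 ⟨Finset.mem_univ φ, hφ⟩) (h1 ▸ Finset.notMem_empty φ)
    · exact h1
  simpa only [F.push_id] using key k k.pos x id Function.injective_id

/-- Maps with image inside `S` are maps to `[|S|]`, so their sum is the hypothesis for the
restriction of `x` to `S`. Removing proper subsets inductively isolates the maps with image exactly
`S`; for the full set these are the permutations, on which `h` takes the value `h x`. -/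
theorem eq_zero_of_forall_sum_rho {F : Construction} {k : ℕ+} {h : F.V k → ℝ}
    (hinv : IsInvariant F h)
    (h0 : ∀ m : ℕ+, m ≤ k → ∀ x : F.V m, ∑ f : Fin k → Fin m, h (F.rho f x) = 0)
    (x : F.V k) : h x = 0 := by
  have hsub : ∀ S : Finset (Fin k),
      ∑ φ : Fin k → Fin k with Finset.univ.image φ ⊆ S, h (F.rho φ x) = 0 := by
    intro S
    rcases S.eq_empty_or_nonempty with rfl | hS
    · refine Finset.sum_eq_zero fun φ hφ => ?_
      have := (Finset.mem_filter.1 hφ).2 (Finset.mem_image_of_mem φ (Finset.mem_univ ⟨0, k.pos⟩))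
      exact absurd this (Finset.notMem_empty _)
    · have hm : S.card ≤ k := by simpa using Finset.card_le_univ S
      have := h0 ⟨S.card, hS.card_pos⟩ hm (F.rho (S.orderEmbOfFin rfl) x)
      rw [← this]
      symm
      refine Finset.sum_bij (fun f _ => S.orderEmbOfFin rfl ∘ f) ?_ ?_ ?_ ?_
      · intro f _
        simp only [Finset.mem_filter, Finset.mem_univ, true_and]
        intro i hi
        obtain ⟨j, _, rfl⟩ := Finset.mem_image.1 hi
        exact Finset.orderEmbOfFin_mem _ _ _
      · intro f _ f' _ hff
        exact (S.orderEmbOfFin rfl).injective.comp_left hff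
      · intro φ hφ
        have hmem : ∀ i, φ i ∈ Set.range (S.orderEmbOfFin rfl) := by
          intro i
          rw [Finset.range_orderEmbOfFin]
          exact (Finset.mem_filter.1 hφ).2 (Finset.mem_image_of_mem _ (Finset.mem_univ i))
        choose r hr using hmem
        exact ⟨r, Finset.mem_univ _, funext hr⟩
      · intro f _
        exact congrArg h (F.rho_rho f _ x)
  have heq : ∀ S : Finset (Fin k),
      ∑ φ : Fin k → Fin k with Finset.univ.image φ = S, h (F.rho φ x) = 0 := by
    intro S
    induction S using Finset.strongInduction with
    | _ S ih =>
    have h1 := hsub S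
    rw [← Finset.sum_fiberwise_of_maps_to (t := S.powerset) (g := fun φ => Finset.univ.image φ)
      (fun φ hφ => Finset.mem_powerset.2 (Finset.mem_filter.1 hφ).2)] at h1
    rw [Finset.sum_eq_single_of_mem S (Finset.mem_powerset_self S)] at h1
    · rw [Finset.filter_filter] at h1
      rw [← h1]
      refine Finset.sum_congr (Finset.filter_congr fun φ _ => ?_) fun _ _ => rfl
      exact ⟨fun h => ⟨h.le, h⟩, fun h => h.2⟩
    · intro T hT hTS
      rw [← ih T (Finset.ssubset_iff_subset_ne.2 ⟨Finset.mem_powerset.1 hT, hTS⟩),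
        Finset.filter_filter]
      refine Finset.sum_congr (Finset.filter_congr fun φ _ => ?_) fun _ _ => rfl
      exact ⟨fun h => h.2, fun h => ⟨h.le.trans (Finset.mem_powerset.1 hT), h⟩⟩
  have htop := heq Finset.univ
  have hterm : ∀ φ ∈ Finset.univ.filter
      fun φ : Fin k → Fin k => Finset.univ.image φ = Finset.univ, h (F.rho φ x) = h x := by
    intro φ hφ
    have hs : Function.Surjective φ := by
      intro j
      have := Finset.mem_univ j
      rw [← (Finset.mem_filter.1 hφ).2] at this
      simpa using this
    have := hinv (Equiv.ofBijective φ (Finite.surjective_iff_bijective.1 hs))⁻¹ x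
    rw [← F.rho_perm] at this
    exact this
  rw [Finset.sum_congr rfl hterm, Finset.sum_const, smul_eq_zero, Finset.card_eq_zero] at htop
  rcases htop with h1 | h1
  · exact absurd (Finset.mem_filter.2 ⟨Finset.mem_univ id, Finset.image_id⟩)
      (h1 ▸ Finset.notMem_empty _)
  · exact h1

theorem eq_of_forall_sample_mean_eq {F : Construction} {U : BaseSeq} {k : ℕ+} {h₁ h₂ : F.V k → ℝ}
    (hinv₁ : IsInvariant F h₁) (hinv₂ : IsInvariant F h₂)
    (h : ∀ m : ℕ+, m ≤ k → ∀ x : F.V m, 𝔼 f : Sample U k m, h₁ (sampleMap F U f x) =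
      𝔼 f : Sample U k m, h₂ (sampleMap F U f x)) : h₁ = h₂ := by
  have hinv : IsInvariant F (h₁ - h₂) := fun g x => by
    rw [Pi.sub_apply, Pi.sub_apply, hinv₁, hinv₂]
  have h0 : ∀ m : ℕ+, m ≤ k → ∀ x : F.V m,
      ∑ f : Sample U k m, (h₁ - h₂) (sampleMap F U f x) = 0 := by
    intro m hm x
    have := h m hm x
    rw [← sub_eq_zero, ← Finset.expect_sub_distrib, Fintype.expect_eq_sum_div_card,
      div_eq_zero_iff] at this
    exact this.resolve_right (Nat.cast_ne_zero.2 Fintype.card_ne_zero)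
  funext x
  rw [← sub_eq_zero]
  cases U
  · exact eq_zero_of_forall_sum_push hinv h0 x
  · exact eq_zero_of_forall_sum_rho hinv h0 x

/-! ## Polynomials and monomials -/

/-- The monomial on `F(ℝⁿ)` given by a tuple of extended coordinates. -/
def monom (F : Construction) {n e : ℕ} (a : (Construction.sym e F).Idx n) (x : F.V n) : ℝ :=
  ∏ i, x.1 (a i)

theorem monom_rho (F : Construction) {m n e : ℕ} (f : Fin m → Fin n)
    (a : (Construction.sym e F).Idx m) (x : F.V n) :
    monom F a (F.rho f x) = monom F ((Construction.sym e F).relabel f a) x :=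
  Finset.prod_congr rfl fun _ _ => F.rho_apply _ _ _

theorem monom_push (F : Construction) {m n e : ℕ} (f : Fin m → Fin n)
    (b : (Construction.sym e F).Idx n) (x : F.V m) :
    monom F b (F.push f x) =
      ∑ a, if (Construction.sym e F).relabel f a = b then monom F a x else 0 := by
  have h1 : monom F b (F.push f x) =
      ∏ i, ∑ a, if F.relabel f a = b i then x.1 a else 0 :=
    Finset.prod_congr rfl fun i _ => F.push_apply _ _ _
  rw [h1, Finset.prod_univ_sum, Fintype.piFinset_univ]
  refine Finset.sum_congr rfl fun a _ => ?_
  split_ifs with h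
  · exact Finset.prod_congr rfl fun i _ => if_pos (congrFun h i)
  · obtain ⟨i, hi⟩ := Function.ne_iff.1 h
    exact Finset.prod_eq_zero (Finset.mem_univ i) (if_neg hi)

/-- Tensor powers commute with push-forward, so moving the point forward amounts to pulling the
weight back. Representing a polynomial as a sampling mean thus becomes a problem about weights on
indices. -/
theorem sum_mul_monom_push (F : Construction) {m n e : ℕ} (f : Fin m → Fin n)
    (v : (Construction.sym e F).Idx n → ℝ) (x : F.V m) :
    ∑ b, v b * monom F b (F.push f x) =
      ∑ a, v ((Construction.sym e F).relabel f a) * monom F a x := by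
  simp only [monom_push, Finset.mul_sum, mul_ite, mul_zero]
  rw [Finset.sum_comm]
  simp

/-- The space of polynomials of degree at most `d` on `F(ℝⁿ)`. -/
def polys (F : Construction) (n d : ℕ) : Submodule ℝ (F.V n → ℝ) where
  carrier := {p | IsPolynomial F d p}
  zero_mem' := ⟨0, by simp, fun x => by simp⟩
  add_mem' := by
    rintro p q ⟨P, hP, hp⟩ ⟨Q, hQ, hq⟩
    exact ⟨P + Q, (MvPolynomial.totalDegree_add _ _).trans (max_le hP hQ),
      fun x => by rw [Pi.add_apply, hp, hq, map_add]⟩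
  smul_mem' := by
    rintro c p ⟨P, hP, hp⟩
    exact ⟨c • P, (MvPolynomial.totalDegree_smul_le _ _).trans hP,
      fun x => by rw [Pi.smul_apply, hp, MvPolynomial.smul_eval, smul_eq_mul]⟩

theorem monom_mem_polys (F : Construction) {n d e : ℕ} (he : e ≤ d)
    (a : (Construction.sym e F).Idx n) : monom F a ∈ polys F n d := by
  refine ⟨∏ i, MvPolynomial.X (a i), ?_, fun x => ?_⟩
  · refine (MvPolynomial.totalDegree_finsetProd _ _).trans ?_
    simpa using he
  · rw [map_prod]
    exact Finset.prod_congr rfl fun i _ => (MvPolynomial.eval_X _).symm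

theorem polys_induction (F : Construction) {n d : ℕ} {P : (F.V n → ℝ) → Prop}
    (h0 : P 0) (hadd : ∀ p q, P p → P q → P (p + q)) (hsmul : ∀ (c : ℝ) p, P p → P (c • p))
    (hmon : ∀ e ≤ d, ∀ a : (Construction.sym e F).Idx n, P (monom F a))
    {p : F.V n → ℝ} (hp : p ∈ polys F n d) : P p := by
  obtain ⟨Q, hQ, hpQ⟩ := hp
  have hp : p = ∑ m ∈ Q.support, MvPolynomial.coeff m Q •
      fun x : F.V n => ∏ i ∈ m.support, x.1 i ^ m i := by
    funext x
    rw [hpQ, MvPolynomial.eval_eq, Finset.sum_apply]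
    rfl
  rw [hp]
  refine Finset.sum_induction _ P hadd h0 fun m hm => hsmul _ _ ?_
  have hmd : m.toMultiset.toList.length ≤ d := by
    rw [Multiset.length_toList, Finsupp.card_toMultiset]
    exact (MvPolynomial.le_totalDegree hm).trans hQ
  -- An exponent vector becomes a tuple by listing each index with its multiplicity.
  have e : (fun x : F.V n => ∏ i ∈ m.support, x.1 i ^ m i) =
      monom F (e := m.toMultiset.toList.length) (fun i => m.toMultiset.toList.get i) := by
    funext x
    have h1 : ∏ i, x.1 (m.toMultiset.toList.get i) = (m.toMultiset.map fun i => x.1 i).prod := by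
      rw [← Multiset.coe_toList m.toMultiset, Multiset.map_coe, Multiset.prod_coe,
        Multiset.coe_toList, ← List.prod_ofFn]
      congr 1
      exact List.ofFn_getElem_eq_map _ _
    refine Eq.trans ?_ h1.symm
    rw [Finsupp.toMultiset_map, Finsupp.prod_toMultiset,
      Finsupp.prod_mapDomain_index (by simp) (by intros; rw [pow_add])]
    rfl
  rw [e]
  exact hmon _ hmd _

theorem continuous_of_mem_polys {F : Construction} {n d : ℕ} {p : F.V n → ℝ}
    (hp : p ∈ polys F n d) : Continuous p := by
  refine polys_induction F continuous_const (fun _ _ h h' => h.add h')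
    (fun c _ h => h.const_smul c) (fun e _ a => ?_) hp
  exact continuous_finsetProd _ fun i _ =>
    (PiLp.continuous_apply 2 _ (a i)).comp continuous_subtype_val

theorem polys_comp_rho {F : Construction} {m n d : ℕ} (f : Fin m → Fin n) {p : F.V m → ℝ}
    (hp : p ∈ polys F m d) : (fun x => p (F.rho f x)) ∈ polys F n d := by
  refine polys_induction F (P := fun p => (fun x => p (F.rho f x)) ∈ polys F n d)
    (zero_mem _) (fun _ _ h h' => add_mem h h') (fun c _ h => Submodule.smul_mem _ c h)
    (fun e he a => ?_) hp
  simp only [monom_rho]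
  exact monom_mem_polys F he _

/-! ## Invariant weights on indices and sampling -/

theorem exists_injOn {n K : ℕ} (hK0 : 0 < K) (S : Finset (Fin n)) (hS : S.card ≤ K) :
    ∃ h : Fin n → Fin K, Set.InjOn h S := by
  obtain ⟨e⟩ := Function.Embedding.nonempty_of_card_le (α := S) (β := Fin K) (by simpa using hS)
  refine ⟨fun i => if h : i ∈ S then e ⟨i, h⟩ else ⟨0, hK0⟩, fun i hi j hj hij => ?_⟩
  simp only [dif_pos (Finset.mem_coe.1 hi), dif_pos (Finset.mem_coe.1 hj)] at hij
  exact congrArg Subtype.val (e.injective hij)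

/-- On the support of `a`, the permutation is `f` followed by the local inverse of `f'`.
Consequently an invariant weight on `[n]` descends to indices over `[K]`. -/
theorem exists_perm_relabel_eq (G : Construction) {n K : ℕ} (hn : 0 < n) {a a' : G.Idx n}
    {f f' : Fin n → Fin K} (hf : Set.InjOn f (G.support a)) (hf' : Set.InjOn f' (G.support a'))
    (h : G.relabel f a = G.relabel f' a') :
    ∃ g : Equiv.Perm (Fin n), G.relabel g a = a' := by
  have : Nonempty (Fin n) := ⟨⟨0, hn⟩⟩
  have hs : (G.support a).image f = (G.support a').image f' := by
    rw [← G.support_relabel, ← G.support_relabel, h]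
  set r := Function.invFunOn f' (G.support a') with hr
  have hl := hf'.leftInvOn_invFunOn
  have hex : ∀ i ∈ G.support a, ∃ i' ∈ G.support a', f i = f' i' := fun i hi => by
    have := Finset.mem_image_of_mem f hi
    rw [hs] at this
    obtain ⟨i', hi', e⟩ := Finset.mem_image.1 this
    exact ⟨i', hi', e.symm⟩
  obtain ⟨g, hg⟩ := exists_perm_extend (I := G.support a) (f := r ∘ f) (by
    intro i hi j hj hij
    obtain ⟨i', hi', e⟩ := hex i hi
    obtain ⟨j', hj', e'⟩ := hex j hj
    simp only [Function.comp_apply, e, e', hr, hl hi', hl hj'] at hij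
    exact hf hi hj (by rw [e, e', hij]))
  refine ⟨g, ?_⟩
  rw [G.relabel_congr hg, ← G.relabel_relabel, h, G.relabel_relabel]
  exact (G.relabel_congr (g := id) fun i hi => hl hi).trans (G.relabel_id a')

theorem card_support_relabel (G : Construction) {m n : ℕ} {f : Fin m → Fin n} {a : G.Idx m} :
    (G.support (G.relabel f a)).card = (G.support a).card ↔ Set.InjOn f (G.support a) := by
  rw [G.support_relabel, Finset.card_image_iff]

/-- The sum over the orbit of an index is a combination of sums over samples `[K] → [n]`. -/
theorem exists_coeff_restrict (G : Construction) {K n : ℕ} (hK0 : 0 < K) (hK : G.deg ≤ K)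
    (hn : 0 < n) (a : G.Idx n) :
    ∃ v : G.Idx K → ℝ, ∀ φ : G.Idx n → ℝ, ∑ g : Equiv.Perm (Fin n), φ (G.relabel g a) =
      ∑ f : Fin K → Fin n, ∑ b, v b * φ (G.relabel f b) := by
  classical
  induction hs : (G.support a).card using Nat.strong_induction_on generalizing a with
  | _ s ih =>
  subst hs
  have : Nonempty (Fin n) := ⟨⟨0, hn⟩⟩
  -- The support of `a` fits into `[K]`, so `a` has a faithful copy `b₀` there, and `c` maps it
  -- back.
  obtain ⟨h, hh⟩ := exists_injOn hK0 (G.support a) ((G.card_support_le a).trans hK)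
  set b₀ := G.relabel h a with hb₀
  set c := Function.invFunOn h (G.support a) with hc
  have hcb : G.relabel c b₀ = a := by
    rw [hb₀, G.relabel_relabel]
    exact (G.relabel_congr (g := id) fun i hi => hh.leftInvOn_invFunOn hi).trans (G.relabel_id a)
  have hcard : (G.support b₀).card = (G.support a).card := (card_support_relabel G).2 hh
  have hcinj : Set.InjOn c (G.support b₀) := by
    rw [← card_support_relabel, hcb, hcard]
  have hinj : ∀ f : Fin K → Fin n, Set.InjOn f (G.support b₀) → ∀ φ : G.Idx n → ℝ,
      ∑ g : Equiv.Perm (Fin n), φ (G.relabel g (G.relabel f b₀)) =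
        ∑ g : Equiv.Perm (Fin n), φ (G.relabel g a) := by
    intro f hf φ
    obtain ⟨g', hg'⟩ := exists_perm_comp_eq hf hcinj
    have e : G.relabel f b₀ = G.relabel g' a := by
      conv_rhs => rw [← hcb, G.relabel_relabel]
      exact (G.relabel_congr hg').symm
    rw [e]
    rw [← Equiv.sum_comp (Equiv.mulRight g')
      (fun g : Equiv.Perm (Fin n) => φ (G.relabel g a))]
    exact Finset.sum_congr rfl fun g _ => by rw [G.relabel_relabel]; rfl
  have hnon : ∀ f : Fin K → Fin n, ∃ v : G.Idx K → ℝ, ¬ Set.InjOn f (G.support b₀) →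
      ∀ φ : G.Idx n → ℝ, ∑ g : Equiv.Perm (Fin n), φ (G.relabel g (G.relabel f b₀)) =
        ∑ f : Fin K → Fin n, ∑ b, v b * φ (G.relabel f b) := by
    intro f
    by_cases hf : Set.InjOn f (G.support b₀)
    · exact ⟨0, fun h => absurd hf h⟩
    · have hlt : (G.support (G.relabel f b₀)).card < (G.support a).card := by
        rw [← hcard]
        refine lt_of_le_of_ne ?_ fun h => hf ((card_support_relabel G).1 h)
        rw [G.support_relabel]
        exact Finset.card_image_le
      obtain ⟨v, hv⟩ := ih _ hlt (G.relabel f b₀) rfl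
      exact ⟨v, fun _ => hv⟩
  choose v hv using hnon
  set A : Finset (Fin K → Fin n) := Finset.univ.filter fun f => Set.InjOn f (G.support b₀)
    with hA
  have hA0 : (A.card : ℝ) ≠ 0 := by
    rw [Nat.cast_ne_zero, Finset.card_ne_zero]
    exact ⟨c, Finset.mem_filter.2 ⟨Finset.mem_univ _, hcinj⟩⟩
  -- Symmetrize the sum of `φ (G.relabel f b₀)` over all samples `f`. Those in `A`, injective on the
  -- support, each give the orbit sum of `a`; the others give orbit sums of smaller support, known
  -- by induction. Solving for the orbit sum of `a` yields this weight.
  refine ⟨fun b => (A.card : ℝ)⁻¹ * ((n.factorial : ℝ) * (if b = b₀ then 1 else 0) -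
    ∑ f ∈ Aᶜ, v f b), fun φ => ?_⟩
  have h1 : (n.factorial : ℝ) * ∑ f : Fin K → Fin n, φ (G.relabel f b₀) =
      A.card * ∑ g : Equiv.Perm (Fin n), φ (G.relabel g a) +
        ∑ f ∈ Aᶜ, ∑ f' : Fin K → Fin n, ∑ b, v f b * φ (G.relabel f' b) := by
    have h2 : ∀ g : Equiv.Perm (Fin n), ∑ f : Fin K → Fin n, φ (G.relabel f b₀) =
        ∑ f : Fin K → Fin n, φ (G.relabel g (G.relabel f b₀)) := by
      intro g
      refine ((Equiv.arrowCongr (Equiv.refl (Fin K)) g).sum_comp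
        (fun f => φ (G.relabel f b₀))).symm.trans ?_
      exact Finset.sum_congr rfl fun f _ => (congrArg φ (G.relabel_relabel g f b₀)).symm
    calc (n.factorial : ℝ) * ∑ f : Fin K → Fin n, φ (G.relabel f b₀)
        = ∑ g : Equiv.Perm (Fin n), ∑ f : Fin K → Fin n, φ (G.relabel f b₀) := by
          rw [Finset.sum_const, Finset.card_univ, Fintype.card_perm, Fintype.card_fin,
            nsmul_eq_mul]
      _ = ∑ f : Fin K → Fin n, ∑ g : Equiv.Perm (Fin n), φ (G.relabel g (G.relabel f b₀)) := by
          rw [Finset.sum_congr rfl fun g _ => h2 g, Finset.sum_comm]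
      _ = _ := by
          rw [← Finset.sum_add_sum_compl A]
          congr 1
          · rw [← nsmul_eq_mul, ← Finset.sum_const]
            exact Finset.sum_congr rfl fun f hf => hinj f (Finset.mem_filter.1 hf).2 φ
          · refine Finset.sum_congr rfl fun f hf => hv f ?_ φ
            intro hf'
            exact Finset.mem_compl.1 hf (Finset.mem_filter.2 ⟨Finset.mem_univ _, hf'⟩)
  have h3 : ∑ f : Fin K → Fin n, ∑ b, ((A.card : ℝ)⁻¹ * ((n.factorial : ℝ) *
      (if b = b₀ then 1 else 0) - ∑ f ∈ Aᶜ, v f b)) * φ (G.relabel f b) =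
      (A.card : ℝ)⁻¹ * ((n.factorial : ℝ) * ∑ f : Fin K → Fin n, φ (G.relabel f b₀) -
        ∑ f ∈ Aᶜ, ∑ f' : Fin K → Fin n, ∑ b, v f b * φ (G.relabel f' b)) := by
    rw [Finset.sum_comm (s := Aᶜ), Finset.mul_sum, ← Finset.sum_sub_distrib, Finset.mul_sum]
    refine Finset.sum_congr rfl fun f _ => ?_
    rw [Finset.sum_comm]
    simp only [mul_assoc, sub_mul, ← Finset.mul_sum, Finset.sum_sub_distrib, Finset.sum_mul]
    congr 3
    simp
  rw [h3, h1, add_sub_cancel_right, inv_mul_cancel_left₀ hA0]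

/-- A bounded invariant weight on indices is a sampling mean of a bounded weight on the indices of
a fixed dimension. -/
theorem exists_coeff_push (G : Construction) {K : ℕ} (hK0 : 0 < K) (hK : G.deg ≤ K) :
    ∃ C : ℝ, 0 ≤ C ∧ ∀ (n : ℕ+) (w : G.Idx n → ℝ) (ε : ℝ), 0 ≤ ε →
      (∀ (g : Equiv.Perm (Fin n)) a, w (G.relabel g a) = w a) → (∀ a, |w a| ≤ ε) →
      ∃ v : G.Idx K → ℝ, (∀ b, |v b| ≤ C * ε) ∧
        ∀ a, w a = 𝔼 f : Fin n → Fin K, v (G.relabel f a) := by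
  classical
  have : Nonempty (Fin K) := ⟨⟨0, hK0⟩⟩
  -- The weight is matched one support size at a time: `s` is the size below which it already
  -- vanishes, and nothing remains once `s` exceeds the degree. The constant is chosen before `n`,
  -- which the uniform rate requires.
  suffices H : ∀ j s : ℕ, G.deg < s + j → ∃ C : ℝ, 0 ≤ C ∧ ∀ (n : ℕ+) (w : G.Idx n → ℝ) (ε : ℝ), 0 ≤ ε →
      (∀ (g : Equiv.Perm (Fin n)) a, w (G.relabel g a) = w a) → (∀ a, |w a| ≤ ε) →
      (∀ a, (G.support a).card < s → w a = 0) →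
      ∃ v : G.Idx K → ℝ, (∀ b, |v b| ≤ C * ε) ∧
        ∀ a, w a = 𝔼 f : Fin n → Fin K, v (G.relabel f a) by
    obtain ⟨C, hC, h⟩ := H (G.deg + 1) 0 (by omega)
    exact ⟨C, hC, fun n w ε h0 h1 h2 => h n w ε h0 h1 h2 fun a ha => absurd ha (Nat.not_lt_zero _)⟩
  have hzero : ∀ s : ℕ, G.deg < s → ∃ C : ℝ, 0 ≤ C ∧ ∀ (n : ℕ+) (w : G.Idx n → ℝ) (ε : ℝ), 0 ≤ ε →
      (∀ (g : Equiv.Perm (Fin n)) a, w (G.relabel g a) = w a) → (∀ a, |w a| ≤ ε) →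
      (∀ a, (G.support a).card < s → w a = 0) →
      ∃ v : G.Idx K → ℝ, (∀ b, |v b| ≤ C * ε) ∧
        ∀ a, w a = 𝔼 f : Fin n → Fin K, v (G.relabel f a) := by
    intro s hs
    refine ⟨0, le_rfl, fun n w ε _ _ _ hw => ⟨0, fun b => by simp, fun a => ?_⟩⟩
    rw [hw a ((G.card_support_le a).trans_lt hs)]
    simp
  intro j
  induction j with
  | zero => exact fun s hs => hzero s hs
  | succ j ih =>
  intro s hsj
  by_cases hs : G.deg < s
  · exact hzero s hs
  push Not at hs
  obtain ⟨C, hC0, hC⟩ := ih (s + 1) (by omega)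
  -- The probability that a sample is injective on a support of size `s`; it does not depend on `n`.
  set κ : ℝ := 𝔼 f : Fin s → Fin K, if Function.Injective f then 1 else 0 with hκ
  have hκ0 : 0 < κ := by
    refine lt_of_lt_of_le ?_ (le_of_eq (Fintype.expect_eq_sum_div_card _).symm)
    refine div_pos (Finset.sum_pos' (fun f _ => by split_ifs <;> norm_num)
      ⟨Fin.castLE (hs.trans hK), Finset.mem_univ _, ?_⟩) (Nat.cast_pos.2 Fintype.card_pos)
    rw [if_pos (Fin.castLE_injective _)]
    exact one_pos
  refine ⟨κ⁻¹ + C * (1 + κ⁻¹), by positivity, fun n w ε hε0 hinv hε hw => ?_⟩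
  -- Transport `w` on indices of support size exactly `s` along faithful relabellings, divided by
  -- `κ`; the choice of `a` is immaterial by invariance. The sampling mean `m` then agrees with `w`
  -- at size `s` and vanishes below, so `w - m` is a case of the induction hypothesis for `s + 1`.
  set v₀ : G.Idx K → ℝ := fun b => if h : ∃ a : G.Idx n, (G.support a).card = s ∧
    (G.support b).card = s ∧ ∃ f : Fin n → Fin K, G.relabel f a = b then κ⁻¹ * w h.choose else 0
    with hv₀
  have hv₀_inj : ∀ (a : G.Idx n) (f : Fin n → Fin K), (G.support a).card = s →
      Set.InjOn f (G.support a) → v₀ (G.relabel f a) = κ⁻¹ * w a := by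
    intro a f ha hf
    have hex : ∃ a' : G.Idx n, (G.support a').card = s ∧
        (G.support (G.relabel f a)).card = s ∧ ∃ f' : Fin n → Fin K,
          G.relabel f' a' = G.relabel f a :=
      ⟨a, ha, ((card_support_relabel G).2 hf).trans ha, f, rfl⟩
    simp only [hv₀, dif_pos hex]
    obtain ⟨h1, h2, f', hf'⟩ := hex.choose_spec
    obtain ⟨g, hg⟩ := exists_perm_relabel_eq G n.pos hf
      ((card_support_relabel G).1
        ((congrArg (fun b => (G.support b).card) hf').trans (h2.trans h1.symm))) hf'.symm
    rw [← hg, hinv]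
  have hv₀_zero : ∀ b, (G.support b).card ≠ s → v₀ b = 0 := by
    intro b hb
    simp only [hv₀]
    rw [dif_neg]
    rintro ⟨a, _, h, _⟩
    exact hb h
  have hv₀_abs : ∀ b, |v₀ b| ≤ κ⁻¹ * ε := by
    intro b
    simp only [hv₀]
    split_ifs with h
    · rw [abs_mul, abs_of_pos (inv_pos.2 hκ0)]
      exact mul_le_mul_of_nonneg_left (hε _) (inv_pos.2 hκ0).le
    · rw [abs_zero]
      positivity
  set m : G.Idx n → ℝ := fun a => 𝔼 f : Fin n → Fin K, v₀ (G.relabel f a) with hm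
  have hle : ∀ (a : G.Idx n) (f : Fin n → Fin K),
      (G.support (G.relabel f a)).card ≤ (G.support a).card := fun a f => by
    rw [G.support_relabel]
    exact Finset.card_image_le
  have hm_eq : ∀ a, (G.support a).card = s → m a = w a := by
    intro a ha
    set ι := (G.support a).orderEmbOfFin ha with hι
    have hrange : Set.range ι = G.support a := Finset.range_orderEmbOfFin _ _
    have h1 : ∀ f : Fin n → Fin K, v₀ (G.relabel f a) =
        κ⁻¹ * w a * if Function.Injective (f ∘ ι) then 1 else 0 := by
      intro f
      have h2 : Function.Injective (f ∘ ι) ↔ Set.InjOn f (G.support a) := by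
        rw [← hrange]
        exact ⟨fun h => h.injOn_range, fun h i j hij =>
          ι.injective (h ⟨i, rfl⟩ ⟨j, rfl⟩ hij)⟩
      split_ifs with hf
      · rw [hv₀_inj a f ha (h2.1 hf), mul_one]
      · rw [mul_zero]
        refine hv₀_zero _ fun h => hf (h2.2 ((card_support_relabel G).1 (h.trans ha.symm)))
    simp only [hm, h1]
    rw [← Finset.mul_expect, (uniformFibers_restrict (n := K) ι.injective).expect_comp
      (fun f : Fin s → Fin K => if Function.Injective f then (1 : ℝ) else 0),
      ← hκ]
    field_simp
  have hm_zero : ∀ a, (G.support a).card < s → m a = 0 := fun a ha =>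
    Finset.expect_eq_zero fun f _ => hv₀_zero _ ((hle a f).trans_lt ha).ne
  have hm_abs : ∀ a, |m a| ≤ κ⁻¹ * ε := fun a =>
    (Finset.abs_expect_le _ _).trans (Finset.expect_le Finset.univ_nonempty fun f _ => hv₀_abs _)
  have hm_inv : ∀ (g : Equiv.Perm (Fin n)) a, m (G.relabel g a) = m a := by
    intro g a
    simp only [hm, G.relabel_relabel]
    exact (uniformFibers_restrict (n := K) g.injective).expect_comp fun f => v₀ (G.relabel f a)
  obtain ⟨v₁, hv₁, hw₁⟩ := hC n (fun a => w a - m a) ((1 + κ⁻¹) * ε) (by positivity)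
    (fun g a => by rw [hinv, hm_inv])
    (fun a => (abs_sub _ _).trans ((add_le_add (hε a) (hm_abs a)).trans_eq (by ring)))
    (fun a ha => by
      rcases Nat.lt_succ_iff_lt_or_eq.1 ha with h | h
      · rw [hw a h, hm_zero a h, sub_zero]
      · rw [hm_eq a h, sub_self])
  refine ⟨fun b => v₀ b + v₁ b, fun b => ?_, fun a => ?_⟩
  · refine (abs_add_le _ _).trans ((add_le_add (hv₀_abs b) (hv₁ b)).trans_eq (by ring))
  · rw [Finset.expect_add_distrib, ← hw₁ a]
    exact (add_sub_cancel _ _).symm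

/-! ## Existence of dual costs -/

theorem exists_sample_mean_of_monom (F : Construction) (U : BaseSeq) {d e : ℕ} (he : e ≤ d)
    {K : ℕ+} (hK : d * F.deg ≤ K) (n : ℕ+) (a : (Construction.sym e F).Idx n) :
    ∃ q ∈ polys F K d, ∀ x : F.V n, ∑ g : Equiv.Perm (Fin n), monom F a (F.act g x) =
      𝔼 f : Sample U K n, q (sampleMap F U f x) := by
  have hdeg : (Construction.sym e F).deg ≤ K := (Nat.mul_le_mul_right _ he).trans hK
  have hreindex : ∀ x : F.V n, ∑ g : Equiv.Perm (Fin n), monom F a (F.act g x) =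
      ∑ g : Equiv.Perm (Fin n), monom F (Construction.relabel (.sym e F) g a) x := by
    intro x
    rw [← Equiv.sum_comp (Equiv.inv (Equiv.Perm (Fin n)))]
    refine Finset.sum_congr rfl fun g _ => ?_
    rw [Equiv.inv_apply, ← F.rho_perm, monom_rho]
  have hq : ∀ v : (Construction.sym e F).Idx K → ℝ, (fun z => ∑ b, v b * monom F b z) ∈ polys F K d := by
    intro v
    have : (fun z => ∑ b, v b * monom F b z) = ∑ b, v b • monom F (n := K) b := by
      funext z
      rw [Finset.sum_apply]
      rfl
    rw [this]
    exact Submodule.sum_mem _ fun b _ => Submodule.smul_mem _ _ (monom_mem_polys F he b)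
  cases U
  · set w : (Construction.sym e F).Idx n → ℝ :=
      fun a' => ∑ g : Equiv.Perm (Fin n), if Construction.relabel (.sym e F) g a = a' then 1 else 0 with hw
    obtain ⟨C, hC0, hC⟩ := exists_coeff_push (.sym e F) K.pos hdeg
    -- Only existence matters here, so any bound on the orbit-counting weight `w` will do.
    obtain ⟨v, _, hv⟩ := hC n w (∑ a', |w a'|) (Finset.sum_nonneg fun _ _ => abs_nonneg _) (by
        intro g a'
        simp only [hw]
        rw [← Equiv.sum_comp (Equiv.mulLeft g)]
        refine Finset.sum_congr rfl fun g' _ => if_congr ?_ rfl rfl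
        rw [← ((Construction.sym e F).relabel_bijective g).1.eq_iff (a := Construction.relabel (.sym e F) g' a), Construction.relabel_relabel]
        rfl)
      (fun a' => Finset.single_le_sum (f := fun a' => |w a'|) (fun _ _ => abs_nonneg _)
        (Finset.mem_univ a'))
    refine ⟨_, hq v, fun x => ?_⟩
    rw [hreindex]
    calc ∑ g : Equiv.Perm (Fin n), monom F (Construction.relabel (.sym e F) g a) x
        = ∑ a', w a' * monom F a' x := by
          simp only [hw, Finset.sum_mul]
          rw [Finset.sum_comm]
          simp
      _ = ∑ a', 𝔼 f : Fin n → Fin K, v (Construction.relabel (.sym e F) f a') * monom F a' x :=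
          Finset.sum_congr rfl fun a' _ => by rw [hv, Finset.expect_mul]
      _ = 𝔼 f : Fin n → Fin K, ∑ a', v (Construction.relabel (.sym e F) f a') * monom F a' x :=
          (Finset.expect_sum_comm _ _ _).symm
      _ = _ := Finset.expect_congr rfl fun f _ => (sum_mul_monom_push F f v x).symm
  · obtain ⟨v, hv⟩ := exists_coeff_restrict (.sym e F) K.pos hdeg n.pos a
    refine ⟨_, Submodule.smul_mem _ (Fintype.card (Sample .D K n) : ℝ) (hq v), fun x => ?_⟩
    rw [hreindex, hv fun a => monom F a x]
    simp only [Pi.smul_apply]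
    rw [← Finset.smul_expect, smul_eq_mul, Fintype.card_mul_expect]
    refine Finset.sum_congr rfl fun f _ => Finset.sum_congr rfl fun b _ => ?_
    exact congrArg _ (monom_rho F _ _ _).symm

/-- By linearity the monomial case covers orbit sums, and for invariant `p` the orbit sum is `n! *
p`. Averaging `q` over permutations of `[K]` makes it invariant without changing its mean, as the
samples are invariant in law. -/
theorem exists_sample_mean (F : Construction) (U : BaseSeq) {d : ℕ} {K : ℕ+}
    (hK : d * F.deg ≤ K) (n : ℕ+) {p : F.V n → ℝ} (hp : IsPolynomial F d p)
    (hinv : IsInvariant F p) :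
    ∃ q : F.V K → ℝ, IsPolynomial F d q ∧ IsInvariant F q ∧
      ∀ x : F.V n, p x = 𝔼 f : Sample U K n, q (sampleMap F U f x) := by
  have h1 : ∃ q ∈ polys F K d, ∀ x : F.V n, ∑ g : Equiv.Perm (Fin n), p (F.act g x) =
      𝔼 f : Sample U K n, q (sampleMap F U f x) := by
    refine polys_induction F (P := fun p => ∃ q ∈ polys F K d, ∀ x : F.V n,
      ∑ g : Equiv.Perm (Fin n), p (F.act g x) =
        𝔼 f : Sample U K n, q (sampleMap F U f x)) ?_ ?_ ?_ ?_ hp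
    · exact ⟨0, zero_mem _, fun x => by simp⟩
    · rintro p p' ⟨q, hq, h⟩ ⟨q', hq', h'⟩
      refine ⟨q + q', add_mem hq hq', fun x => ?_⟩
      simp only [Pi.add_apply, Finset.sum_add_distrib, Finset.expect_add_distrib, h, h']
    · rintro c p ⟨q, hq, h⟩
      refine ⟨c • q, Submodule.smul_mem _ _ hq, fun x => ?_⟩
      simp only [Pi.smul_apply, smul_eq_mul, ← Finset.mul_sum, ← Finset.mul_expect, h]
    · exact fun e he a => exists_sample_mean_of_monom F U he hK n a
  obtain ⟨q, hq, hpq⟩ := h1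
  set N : ℝ := ((n : ℕ).factorial : ℝ) with hN
  have hN0 : N ≠ 0 := Nat.cast_ne_zero.2 (Nat.factorial_ne_zero _)
  have hsum : ∀ x, ∑ g : Equiv.Perm (Fin n), p (F.act g x) = N * p x := by
    intro x
    simp only [hinv _ x, Finset.sum_const, Finset.card_univ, Fintype.card_perm,
      Fintype.card_fin, nsmul_eq_mul, hN]
  refine ⟨fun z => 𝔼 g : Equiv.Perm (Fin K), N⁻¹ * q (F.act g z), ?_, ?_, fun x => ?_⟩
  · have : (fun z => 𝔼 g : Equiv.Perm (Fin K), N⁻¹ * q (F.act g z)) =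
        ((Fintype.card (Equiv.Perm (Fin K)) : ℝ)⁻¹ * N⁻¹) •
          ∑ g : Equiv.Perm (Fin K), fun z => q (F.act g z) := by
      funext z
      rw [Fintype.expect_eq_sum_div_card, ← Finset.mul_sum, Pi.smul_apply, Finset.sum_apply,
        smul_eq_mul]
      ring
    have h2 : (fun z => 𝔼 g : Equiv.Perm (Fin K), N⁻¹ * q (F.act g z)) ∈ polys F K d := by
      rw [this]
      exact Submodule.smul_mem _ _ (Submodule.sum_mem _ fun g _ => polys_comp_rho _ hq)
    exact h2
  · intro g z
    refine Fintype.expect_equiv (Equiv.mulRight g) _ _ fun g' => ?_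
    have : F.act g' (F.act g z) = F.act (g' * g) z := by
      simp only [← F.push_perm, F.push_push]
      rfl
    rw [this]
    rfl
  · have h3 : ∀ g : Equiv.Perm (Fin K),
        𝔼 f : Sample U K n, q (F.act g (sampleMap F U f x)) = N * p x := by
      intro g
      obtain ⟨π, hπ, h⟩ := exists_sample_act F U (n := n) g
      simp only [h]
      rw [hπ.expect_comp fun f => q (sampleMap F U f x), ← hpq, hsum]
    rw [Finset.expect_comm]
    simp only [← Finset.mul_expect, h3]
    rw [Fintype.expect_const, inv_mul_cancel_left₀ hN0]

theorem exists_prec (U : BaseSeq) (K : ℕ+) : ∃ N : ℕ+, ∀ m ≤ K, U.Prec m N := by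
  cases U
  · exact ⟨K, fun m hm => hm⟩
  · exact ⟨⟨(K : ℕ).factorial, Nat.factorial_pos _⟩, fun m hm => Nat.dvd_factorial m.pos hm⟩

theorem exists_prec_prec (U : BaseSeq) (m n : ℕ+) : ∃ N : ℕ+, U.Prec m N ∧ U.Prec n N := by
  cases U
  · exact ⟨max m n, le_max_left m n, le_max_right m n⟩
  · exact ⟨m * n, Dvd.intro _ rfl, Dvd.intro_left _ rfl⟩

theorem BaseSeq.Prec.trans {U : BaseSeq} {l m n : ℕ+} (h : U.Prec l m) (h' : U.Prec m n) :
    U.Prec l n := by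
  cases U
  · exact le_trans (α := ℕ+) h h'
  · exact dvd_trans (α := ℕ) h h'

theorem exists_dualCost {F : Construction} {U : BaseSeq} {d : ℕ} {p : ∀ n : ℕ+, F.V n → ℝ}
    (hp : FreelyDescribed F U d p) :
    ∃ (k : ℕ+) (q : F.V k → ℝ), IsPolynomial F d q ∧ IsInvariant F q ∧ IsDualCost F U p q := by
  -- The `+ 1` only ensures positivity.
  set K : ℕ+ := ⟨d * F.deg + 1, Nat.succ_pos _⟩ with hK
  have hKd : d * F.deg ≤ K := Nat.le_succ _
  choose q hqd hqinv hq using fun N : ℕ+ =>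
    exists_sample_mean F U hKd N (hp.polynomial N) (hp.invariant N)
  have hrep : ∀ n N : ℕ+, U.Prec n N → ∀ x : F.V n,
      p n x = 𝔼 f : Sample U K n, q N (sampleMap F U f x) := by
    intro n N h x
    obtain ⟨π, hπ, hπx⟩ := exists_sample_emb F U (k := K) h
    rw [← hp.compatible n N h x, hq]
    simp only [hπx]
    exact hπ.expect_comp fun f => q N (sampleMap F U f x)
  -- `N₀` lies above every dimension `m ≤ K`. Beyond it, `q N` has prescribed sampling means in all
  -- these dimensions and therefore no longer depends on `N`.
  obtain ⟨N₀, hN₀⟩ := exists_prec U K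
  refine ⟨K, q N₀, hqd N₀, hqinv N₀, ⟨d, hqd N₀⟩, fun n x => ?_⟩
  obtain ⟨N, h0, hn⟩ := exists_prec_prec U N₀ n
  have : q N₀ = q N := eq_of_forall_sample_mean_eq (U := U) (hqinv _) (hqinv _) fun m hm y => by
    rw [← hrep m N₀ (hN₀ m hm), ← hrep m N ((hN₀ m hm).trans h0)]
  rw [deFinettiMean_eq, this]
  exact hrep n N hn x

/-! ## Symmetrization -/

theorem act_act (F : Construction) {n : ℕ} (g h : Equiv.Perm (Fin n)) (x : F.V n) :
    F.act g (F.act h x) = F.act (g * h) x := by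
  simp only [← F.push_perm, F.push_push]
  rfl

theorem symTo_isInvariant (F : Construction) (B : BaseSeq) {k n : ℕ+} (q : F.V k → ℝ) :
    IsInvariant F (symTo F B n q) := by
  intro g x
  rw [symTo_eq, symTo_eq]
  refine Fintype.expect_equiv (Equiv.mulLeft g⁻¹) _ _ fun g' => ?_
  rw [act_act, Equiv.coe_mulLeft, mul_inv_rev, inv_inv]

/-- Permuting and projecting a sample in dimension `n` gives a uniform sample in dimension `k`.
Together with invariance this characterises `symTo`, so its identities follow from
`eq_of_forall_sample_mean_eq` with no computation over permutations. -/
theorem expect_symTo_sampleMap (F : Construction) (U : BaseSeq) {k n m : ℕ+}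
    (h : U.opp.Prec k n) (q : F.V k → ℝ) (x : F.V m) :
    𝔼 f : Sample U n m, symTo F U.opp n q (sampleMap F U f x) =
      𝔼 f : Sample U k m, q (sampleMap F U f x) := by
  simp only [symTo_eq]
  rw [Finset.expect_comm]
  obtain ⟨π, hπ, hπx⟩ := exists_sample_proj F U (n := m) h
  have h1 : ∀ g : Equiv.Perm (Fin n), 𝔼 f : Sample U n m,
      q (proj F U.opp k n (F.act g⁻¹ (sampleMap F U f x))) =
        𝔼 f : Sample U k m, q (sampleMap F U f x) := by
    intro g
    obtain ⟨π', hπ', hπx'⟩ := exists_sample_act F U (n := m) g⁻¹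
    simp only [hπx', hπx]
    rw [hπ'.expect_comp fun f => q (sampleMap F U (π f) x),
      hπ.expect_comp fun f => q (sampleMap F U f x)]
  simp only [h1]
  rw [Fintype.expect_const]

theorem symTo_symTo (F : Construction) (U : BaseSeq) {k n N : ℕ+} (hkn : U.opp.Prec k n)
    (hnN : U.opp.Prec n N) (q : F.V k → ℝ) :
    symTo F U.opp N (symTo F U.opp n q) = symTo F U.opp N q :=
  eq_of_forall_sample_mean_eq (U := U) (symTo_isInvariant F _ _) (symTo_isInvariant F _ _)
    fun m _ x => by
      rw [expect_symTo_sampleMap F U hnN, expect_symTo_sampleMap F U hkn,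
        expect_symTo_sampleMap F U (hkn.trans hnN)]

theorem IsDualCost.eq_expect {F : Construction} {U : BaseSeq} {p : ∀ n : ℕ+, F.V n → ℝ} {k : ℕ+}
    {q : F.V k → ℝ} (hq : IsDualCost F U p q) (n : ℕ+) (x : F.V n) :
    p n x = 𝔼 f : Sample U k n, q (sampleMap F U f x) :=
  (hq.2 n x).trans (deFinettiMean_eq F U q x)

theorem IsDualCost.eq_expect_symTo {F : Construction} {U : BaseSeq} {p : ∀ n : ℕ+, F.V n → ℝ}
    {k : ℕ+} {q : F.V k → ℝ} (hq : IsDualCost F U p q) {n : ℕ+} (h : U.opp.Prec k n) (m : ℕ+)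
    (x : F.V m) :
    p m x = 𝔼 f : Sample U n m, symTo F U.opp n q (sampleMap F U f x) := by
  rw [hq.eq_expect, expect_symTo_sampleMap F U h]

theorem IsDualCost.symTo_eq_symTo {F : Construction} {U : BaseSeq} {p : ∀ n : ℕ+, F.V n → ℝ}
    {k₁ k₂ : ℕ+} {q₁ : F.V k₁ → ℝ} {q₂ : F.V k₂ → ℝ} (h₁ : IsDualCost F U p q₁)
    (h₂ : IsDualCost F U p q₂) {n : ℕ+} (hk₁ : U.opp.Prec k₁ n) (hk₂ : U.opp.Prec k₂ n) :
    symTo F U.opp n q₁ = symTo F U.opp n q₂ :=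
  eq_of_forall_sample_mean_eq (U := U) (symTo_isInvariant F _ _) (symTo_isInvariant F _ _)
    fun m _ x => by rw [← h₁.eq_expect_symTo hk₁, ← h₂.eq_expect_symTo hk₂]

theorem IsDualCost.continuous {F : Construction} {U : BaseSeq} {p : ∀ n : ℕ+, F.V n → ℝ} {k : ℕ+}
    {q : F.V k → ℝ} (hq : IsDualCost F U p q) : Continuous q := by
  obtain ⟨d, hd⟩ := hq.1
  exact continuous_of_mem_polys (d := d) hd

theorem continuous_symTo (F : Construction) (B : BaseSeq) {k n : ℕ+} {q : F.V k → ℝ}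
    (hq : Continuous q) : Continuous (symTo F B n q) := by
  refine Continuous.div_const (continuous_finsetSum _ fun g _ => ?_) _
  exact hq.comp ((LinearMap.continuous_of_finiteDimensional _).comp
    (LinearMap.continuous_of_finiteDimensional _))

/-! ## Optimal values -/

theorem optVal_le {X : Type*} [TopologicalSpace X] {S : Set X} (hS : IsCompact S) {p : X → ℝ}
    (hp : Continuous p) {x : X} (hx : x ∈ S) : optVal S p ≤ p x :=
  csInf_le (hS.image hp).bddBelow (Set.mem_image_of_mem p hx)

theorem le_optVal {X : Type*} {S : Set X} (hS : S.Nonempty) {p : X → ℝ} {c : ℝ}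
    (h : ∀ x ∈ S, c ≤ p x) : c ≤ optVal S p :=
  le_csInf (hS.image p) (by rintro _ ⟨x, hx, rfl⟩; exact h x hx)

theorem exists_optVal_eq {X : Type*} [TopologicalSpace X] {S : Set X} (hS : IsCompact S)
    (hne : S.Nonempty) {p : X → ℝ} (hp : Continuous p) : ∃ x ∈ S, optVal S p = p x := by
  obtain ⟨x, hx, h⟩ := (hS.image hp).sInf_mem (hne.image p)
  exact ⟨x, hx, h.symm⟩

theorem optVal_sub_optVal_le {X : Type*} [TopologicalSpace X] {S : Set X} (hS : IsCompact S)
    (hne : S.Nonempty) {p q : X → ℝ} (hp : Continuous p) (hq : Continuous q) {c : ℝ}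
    (h : ∀ x ∈ S, p x - q x ≤ c) : optVal S p - optVal S q ≤ c := by
  obtain ⟨x, hx, e⟩ := exists_optVal_eq hS hne hq
  have h1 := optVal_le hS hp hx
  have h2 := h x hx
  rw [e]
  linarith

section Bounds

variable {F : Construction} {U : BaseSeq} {Ω : ∀ n : ℕ+, Set (F.V n)}

theorem optVal_symTo_mono (hΩ : FSCompatible F U Ω) (hcompact : ∀ n, IsCompact (Ω n))
    (hne : ∀ n, (Ω n).Nonempty) {k n N : ℕ+} (hkn : U.opp.Prec k n) (hnN : U.opp.Prec n N)
    {q : F.V k → ℝ} (hq : Continuous q) :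
    optVal (Ω n) (symTo F U.opp n q) ≤ optVal (Ω N) (symTo F U.opp N q) := by
  refine le_optVal (hne N) fun x hx => ?_
  rw [← symTo_symTo F U hkn hnN, symTo_eq]
  refine Finset.le_expect Finset.univ_nonempty fun g _ => ?_
  exact optVal_le (hcompact n) (continuous_symTo F _ hq)
    (hΩ.projects _ _ hnN _ (hΩ.invariant _ _ _ hx))

theorem optVal_symTo_le (hΩ : FSCompatible F U Ω) (hcompact : ∀ n, IsCompact (Ω n))
    (hne : ∀ n, (Ω n).Nonempty) {p : ∀ n : ℕ+, F.V n → ℝ} {k n : ℕ+} {q : F.V k → ℝ}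
    (hq : IsDualCost F U p q) (hkn : U.opp.Prec k n) (m : ℕ+) :
    optVal (Ω n) (symTo F U.opp n q) ≤ optVal (Ω m) (p m) := by
  refine le_optVal (hne m) fun x hx => ?_
  rw [hq.eq_expect_symTo hkn]
  refine Finset.le_expect Finset.univ_nonempty fun f _ => ?_
  exact optVal_le (hcompact n) (continuous_symTo F _ hq.continuous) (hΩ.sampleMap_mem f hx)

end Bounds

/-! ## Freely-described measures -/

/-- The law of the random vector `L x`, where `L : F(ℝⁿ) → F(ℝᵏ)` is the de Finetti map. -/
def sampleLaw (F : Construction) (U : BaseSeq) (k : ℕ) {n : ℕ} (x : F.V n) : Measure (F.V k) :=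
  (Fintype.card (Sample U k n) : ENNReal)⁻¹ • ∑ f : Sample U k n, Measure.dirac (sampleMap F U f x)

theorem sampleLaw_map {F : Construction} {U : BaseSeq} {k k' n : ℕ+} {x : F.V n}
    {T : F.V k →ₗ[ℝ] F.V k'} {π : Sample U k n → Sample U k' n} (hπ : UniformFibers π)
    (h : ∀ f, T (sampleMap F U f x) = sampleMap F U (π f) x) :
    (sampleLaw F U k x).map T = sampleLaw F U k' x := by
  have hT : Measurable T := (LinearMap.continuous_of_finiteDimensional T).measurable
  obtain ⟨c, hc, hsum⟩ := hπ.exists_sum_comp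
  have hc0 : c ≠ 0 := by
    rintro rfl
    rw [zero_mul] at hc
    exact Fintype.card_ne_zero hc
  rw [sampleLaw, sampleLaw, Measure.map_smul, ← Measure.mapₗ_apply_of_measurable hT, map_sum]
  simp only [Measure.mapₗ_apply_of_measurable hT, Measure.map_dirac' hT, h]
  rw [hsum fun f => Measure.dirac (sampleMap F U f x), hc, Nat.cast_mul,
    ← Nat.cast_smul_eq_nsmul ENNReal, smul_smul,
    ENNReal.mul_inv (Or.inl (Nat.cast_ne_zero.2 hc0)) (Or.inl (ENNReal.natCast_ne_top _)),
    mul_right_comm, ENNReal.inv_mul_cancel (Nat.cast_ne_zero.2 hc0) (ENNReal.natCast_ne_top _),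
    one_mul]

theorem ae_sampleLaw {F : Construction} {U : BaseSeq} {k n : ℕ} {x : F.V n} {S : Set (F.V k)}
    (hS : MeasurableSet S) (h : ∀ f : Sample U k n, sampleMap F U f x ∈ S) :
    ∀ᵐ y ∂sampleLaw F U k x, y ∈ S := by
  rw [ae_iff, sampleLaw, Measure.smul_apply, Measure.finsetSum_apply,
    Finset.sum_eq_zero, smul_zero]
  intro f _
  have : {a | ¬ a ∈ S} = Sᶜ := rfl
  rw [this, Measure.dirac_apply' _ hS.compl, Set.indicator_of_notMem (by simpa using h f)]

instance isProbabilityMeasure_sampleLaw {F : Construction} {U : BaseSeq} {k n : ℕ+} {x : F.V n} :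
    IsProbabilityMeasure (sampleLaw F U k x) := by
  constructor
  rw [sampleLaw, Measure.smul_apply, Measure.finsetSum_apply]
  simp only [measure_univ, Finset.sum_const, Finset.card_univ, nsmul_eq_mul, mul_one, smul_eq_mul]
  exact ENNReal.inv_mul_cancel (Nat.cast_ne_zero.2 Fintype.card_ne_zero)
    (ENNReal.natCast_ne_top _)

theorem integral_sampleLaw {F : Construction} {U : BaseSeq} {k n : ℕ} {x : F.V n}
    (q : F.V k → ℝ) :
    ∫ y, q y ∂sampleLaw F U k x = 𝔼 f : Sample U k n, q (sampleMap F U f x) := by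
  rw [sampleLaw, integral_smul_measure, integral_finsetSum_measure
    fun f _ => integrable_dirac (by simp), Fintype.expect_eq_sum_div_card]
  simp only [integral_dirac, ENNReal.toReal_inv, ENNReal.toReal_natCast, smul_eq_mul]
  rw [inv_mul_eq_div]

section Measures

variable {F : Construction} {U : BaseSeq} {Ω : ∀ n : ℕ+, Set (F.V n)}

theorem freelyDescribedMeasure_sampleLaw (hΩ : FSCompatible F U Ω)
    (hcompact : ∀ n, IsCompact (Ω n)) {m : ℕ+} {x : F.V m} (hx : x ∈ Ω m) :
    FreelyDescribedMeasure F U.opp Ω fun n => sampleLaw F U n x where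
  prob _ := inferInstance
  support n := ae_sampleLaw (hcompact n).measurableSet fun f => hΩ.sampleMap_mem f hx
  invariant n g := by
    obtain ⟨π, hπ, h⟩ := exists_sample_act F U (n := m) g
    exact sampleLaw_map hπ fun f => h f x
  projects n N h := by
    obtain ⟨π, hπ, h⟩ := exists_sample_proj F U (n := m) h
    exact sampleLaw_map hπ fun f => h f x

theorem FreelyDescribedMeasure.integrable {B : BaseSeq} {μ : ∀ n : ℕ+, Measure (F.V n)}
    (hμ : FreelyDescribedMeasure F B Ω μ) (hcompact : ∀ n, IsCompact (Ω n)) {n : ℕ+}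
    {q : F.V n → ℝ} (hq : Continuous q) : Integrable q (μ n) := by
  have := hμ.prob n
  obtain ⟨C, hC⟩ := (hcompact n).exists_bound_of_continuousOn hq.continuousOn
  exact Integrable.of_bound hq.aestronglyMeasurable C ((hμ.support n).mono fun x hx => hC x hx)

/-- Consistency moves the integral to dimension `n`, and invariance makes every permuted term
contribute equally. -/
theorem FreelyDescribedMeasure.integral_eq {B : BaseSeq} {μ : ∀ n : ℕ+, Measure (F.V n)}
    (hμ : FreelyDescribedMeasure F B Ω μ) (hcompact : ∀ n, IsCompact (Ω n)) {k n : ℕ+}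
    (h : B.Prec k n) {q : F.V k → ℝ} (hq : Continuous q) :
    ∫ x, q x ∂μ k = ∫ x, symTo F B n q x ∂μ n := by
  have hcproj : Continuous (proj F B k n) := LinearMap.continuous_of_finiteDimensional _
  have hcact : ∀ g : Equiv.Perm (Fin n), Continuous (F.act g) := fun g =>
    LinearMap.continuous_of_finiteDimensional _
  have h1 : ∫ x, q x ∂μ k = ∫ x, q (proj F B k n x) ∂μ n := by
    conv_lhs => rw [← hμ.projects k n h]
    exact integral_map hcproj.aemeasurable hq.aestronglyMeasurable
  have h2 : ∀ g : Equiv.Perm (Fin n),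
      ∫ x, q (proj F B k n (F.act g x)) ∂μ n = ∫ x, q x ∂μ k := by
    intro g
    rw [h1]
    conv_rhs => rw [← hμ.invariant n g]
    exact (integral_map (hcact g).aemeasurable
      (hq.comp hcproj).aestronglyMeasurable).symm
  have h3 : ∫ x, symTo F B n q x ∂μ n =
      (∑ g : Equiv.Perm (Fin n), ∫ x, q (proj F B k n (F.act g⁻¹ x)) ∂μ n) /
        (n : ℕ).factorial := by
    simp only [symTo]
    rw [integral_div, integral_finsetSum]
    exact fun g _ => hμ.integrable hcompact (hq.comp (hcproj.comp (hcact _)))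
  rw [h3]
  simp only [h2, Finset.sum_const, Finset.card_univ, Fintype.card_perm, Fintype.card_fin,
    nsmul_eq_mul]
  rw [mul_div_cancel_left₀ _ (Nat.cast_ne_zero.2 (Nat.factorial_ne_zero _))]

theorem FreelyDescribedMeasure.optVal_le_integral {B : BaseSeq}
    {μ : ∀ n : ℕ+, Measure (F.V n)} (hμ : FreelyDescribedMeasure F B Ω μ)
    (hcompact : ∀ n, IsCompact (Ω n)) {k n : ℕ+} (h : B.Prec k n) {q : F.V k → ℝ}
    (hq : Continuous q) : optVal (Ω n) (symTo F B n q) ≤ ∫ x, q x ∂μ k := by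
  have := hμ.prob n
  rw [hμ.integral_eq hcompact h hq]
  have hc := continuous_symTo F B (n := n) hq
  calc optVal (Ω n) (symTo F B n q) = ∫ _, optVal (Ω n) (symTo F B n q) ∂μ n := by simp
    _ ≤ ∫ x, symTo F B n q x ∂μ n :=
      integral_mono_ae (integrable_const _) (hμ.integrable hcompact hc)
        ((hμ.support n).mono fun x hx => optVal_le (hcompact n) hc hx)

end Measures

/-! ## Collision probabilities and permutation averages -/

theorem expect_ite_apply_eq {N m : ℕ} (hm : 0 < m) {i j : Fin N} (hij : i ≠ j) :
    𝔼 f : Fin N → Fin m, (if f i = f j then (1 : ℝ) else 0) = (m : ℝ)⁻¹ := by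
  have : Nonempty (Fin m) := ⟨⟨0, hm⟩⟩
  have hinj : Function.Injective ![i, j] := by
    intro a b hab
    fin_cases a <;> fin_cases b <;> simp_all [eq_comm]
  have h1 := (uniformFibers_restrict (n := m) hinj).expect_comp
    (fun f : Fin 2 → Fin m => if f 0 = f 1 then (1 : ℝ) else 0)
  refine h1.trans ?_
  refine (Fintype.expect_equiv (finTwoArrowEquiv (Fin m)) _
    (fun p : Fin m × Fin m => if p.1 = p.2 then (1 : ℝ) else 0) fun f => rfl).trans ?_
  rw [← Finset.univ_product_univ, Finset.expect_product]
  simp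

theorem expect_perm_apply {n : ℕ} (i : Fin n) (φ : Fin n → ℝ) :
    𝔼 g : Equiv.Perm (Fin n), φ (g i) = 𝔼 j, φ j := by
  have : Nonempty (Fin n) := ⟨i⟩
  have h : ∀ j, 𝔼 g : Equiv.Perm (Fin n), φ (g j) = 𝔼 g : Equiv.Perm (Fin n), φ (g i) := by
    intro j
    refine Fintype.expect_equiv (Equiv.mulRight (Equiv.swap i j)) _ _ fun g => ?_
    rw [Equiv.coe_mulRight, Equiv.Perm.mul_apply, Equiv.swap_apply_left]
  rw [← Fintype.expect_const (ι := Fin n) (𝔼 g : Equiv.Perm (Fin n), φ (g i)),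
    ← Finset.expect_congr rfl fun j _ => h j, Finset.expect_comm,
    Finset.expect_congr rfl fun g _ => Fintype.expect_equiv g (fun j => φ (g j)) φ fun _ => rfl,
    Fintype.expect_const]

/-! ## Sampling without replacement -/

theorem expect_not_injective_le {k n : ℕ} (hn : 0 < n) :
    2 * 𝔼 f : Fin k → Fin n, (if Function.Injective f then (0 : ℝ) else 1) ≤
      (k : ℝ) * (k - 1) / n := by
  have h1 : ∀ f : Fin k → Fin n, 2 * (if Function.Injective f then (0 : ℝ) else 1) ≤
      ∑ p ∈ (Finset.univ : Finset (Fin k)).offDiag, if f p.1 = f p.2 then (1 : ℝ) else 0 := by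
    intro f
    split_ifs with hf
    · rw [mul_zero]
      exact Finset.sum_nonneg fun _ _ => by split_ifs <;> norm_num
    · obtain ⟨i, j, hij, hne⟩ := Function.not_injective_iff.1 hf
      -- A collision is counted by both ordered pairs. This factor `2` later absorbs the one in `|S
      -- f - S f'| ≤ 2 * M`.
      have hsub : ({(i, j), (j, i)} : Finset (Fin k × Fin k)) ⊆ Finset.univ.offDiag := by
        intro p hp
        simp only [Finset.mem_insert, Finset.mem_singleton] at hp
        rcases hp with rfl | rfl
        · simpa using hne
        · simpa using hne.symm
      refine le_trans (le_of_eq ?_) (Finset.sum_le_sum_of_subset_of_nonneg hsub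
        fun _ _ _ => by split_ifs <;> norm_num)
      rw [Finset.sum_pair (by simp [hne]), if_pos hij, if_pos hij.symm]
      norm_num
  rw [Finset.mul_expect]
  refine (Finset.expect_le_expect fun f _ => h1 f).trans (le_of_eq ?_)
  rw [Finset.expect_sum_comm, Finset.sum_congr rfl fun p hp =>
    expect_ite_apply_eq hn (Finset.mem_offDiag.1 hp).2.2, Finset.sum_const, Finset.offDiag_card,
    nsmul_eq_mul, Finset.card_univ, Fintype.card_fin, Nat.cast_sub (Nat.le_mul_self k)]
  push_cast
  ring

/-- After averaging over permutations, all injective samples give the same value, namely `symTo`.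
Only samples with a collision contribute to the difference. -/
theorem expect_sub_symTo_Z_le (F : Construction) {k n : ℕ+} (h : (k : ℕ) ≤ n) (q : F.V k → ℝ)
    (x : F.V n) {M : ℝ} (hM : ∀ f : Fin k → Fin n, |q (F.rho f x)| ≤ M) :
    𝔼 f : Fin k → Fin n, q (F.rho f x) - symTo F .Z n q x ≤
      (k : ℝ) * ((k : ℝ) - 1) / n * M := by
  set S : (Fin k → Fin n) → ℝ := fun f => 𝔼 g : Equiv.Perm (Fin n), q (F.rho (g ∘ f) x) with hS
  have hmean : 𝔼 f : Fin k → Fin n, q (F.rho f x) = 𝔼 f, S f := by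
    simp only [hS]
    rw [Finset.expect_comm, ← Fintype.expect_const (ι := Equiv.Perm (Fin n))
      (𝔼 f : Fin k → Fin n, q (F.rho f x))]
    exact Finset.expect_congr rfl fun g _ =>
      ((uniformFibers_comp (uniformFibers_of_bijective g.bijective)).expect_comp
        fun f => q (F.rho f x)).symm
  have hsym : symTo F .Z n q x = S (Fin.castLE h) := by
    rw [symTo_eq]
    refine Finset.expect_congr rfl fun g _ => ?_
    rw [proj_Z F h, ← F.rho_perm, F.rho_rho]
  have hinj : ∀ f, Function.Injective f → S f = S (Fin.castLE h) := by
    intro f hf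
    obtain ⟨g', hg'⟩ := exists_perm_comp_eq (I := Finset.univ) hf.injOn
      (Fin.castLE_injective h).injOn
    refine Fintype.expect_equiv (Equiv.mulRight g') _ _ fun g => ?_
    refine congrArg (fun φ => q (F.rho φ x)) (funext fun i => ?_)
    exact congrArg g (hg' i (Finset.mem_univ i)).symm
  have habs : ∀ f, |S f| ≤ M := fun f => (Finset.abs_expect_le _ _).trans
    (Finset.expect_le Finset.univ_nonempty fun g _ => hM _)
  have hM0 : 0 ≤ M := (abs_nonneg _).trans (habs (Fin.castLE h))
  rw [hmean, hsym, ← Fintype.expect_const (ι := Fin k → Fin n) (S (Fin.castLE h)),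
    ← Finset.expect_sub_distrib]
  have hterm : ∀ f, S f - S (Fin.castLE h) ≤
      2 * M * if Function.Injective f then (0 : ℝ) else 1 := by
    intro f
    split_ifs with hf
    · rw [hinj f hf, sub_self, mul_zero]
    · have h1 := abs_le.1 (habs f)
      have h2 := abs_le.1 (habs (Fin.castLE h))
      linarith [h1.2, h2.1]
  refine (Finset.expect_le_expect fun f _ => hterm f).trans ?_
  rw [← Finset.mul_expect]
  have := mul_le_mul_of_nonneg_right (expect_not_injective_le (k := k) n.pos) hM0
  linarith

/-! ## Coupling of uniform maps with balanced maps -/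

/-- Every map `[n] → [k]` can be made balanced by changing as many values as there are excess
elements in its fibres. -/
theorem exists_balanced {n k m : ℕ} (hn : n = k * m) (f : Fin n → Fin k) :
    ∃ f' : Fin n → Fin k, (∀ j, (Finset.univ.filter fun i => f' i = j).card = m) ∧
      (Finset.univ.filter fun i => f i ≠ f' i).card ≤
        ∑ j, ((Finset.univ.filter fun i => f i = j).card - m) := by
  induction hΦ : ∑ j, ((Finset.univ.filter fun i => f i = j).card - m)
    using Nat.strong_induction_on generalizing f with
  | _ Φ ih =>
  subst hΦ
  have hcard : ∑ j, (Finset.univ.filter fun i => f i = j).card = ∑ _j : Fin k, m := by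
    rw [← Finset.card_eq_sum_card_fiberwise (fun i _ => Finset.mem_coe.2 (Finset.mem_univ (f i)))]
    simp [hn]
  by_cases hbal : ∀ j, (Finset.univ.filter fun i => f i = j).card ≤ m
  · refine ⟨f, fun j => ?_, by simp⟩
    exact (Finset.sum_eq_sum_iff_of_le fun j _ => hbal j).1 hcard j (Finset.mem_univ j)
  · push Not at hbal
    obtain ⟨j, hj⟩ := hbal
    obtain ⟨j', hj'⟩ : ∃ j', (Finset.univ.filter fun i => f i = j').card < m := by
      by_contra hcon
      push Not at hcon
      exact absurd hcard.symm (Finset.sum_lt_sum (fun l _ => hcon l) ⟨j, Finset.mem_univ j, hj⟩).ne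
    have hjj : j ≠ j' := by
      rintro rfl
      exact absurd hj hj'.not_gt
    obtain ⟨i, hi⟩ := Finset.card_pos.1 ((Nat.zero_le m).trans_lt hj)
    have hfi : f i = j := (Finset.mem_filter.1 hi).2
    -- Move one element from an overfull fibre to an underfull one: the latter stays within `m`, so
    -- the total excess drops.
    set f₂ := Function.update f i j' with hf₂
    have hsub : ∀ l, l ≠ j' → (Finset.univ.filter fun a => f₂ a = l) ⊆
        (Finset.univ.filter fun a => f a = l).erase i := by
      intro l hl a ha
      have ha' := (Finset.mem_filter.1 ha).2
      have hai : a ≠ i := by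
        rintro rfl
        rw [hf₂, Function.update_self] at ha'
        exact hl ha'.symm
      rw [hf₂, Function.update_of_ne hai] at ha'
      exact Finset.mem_erase.2 ⟨hai, Finset.mem_filter.2 ⟨Finset.mem_univ a, ha'⟩⟩
    have hsub' : (Finset.univ.filter fun a => f₂ a = j') ⊆
        insert i (Finset.univ.filter fun a => f a = j') := by
      intro a ha
      by_cases hai : a = i
      · exact hai ▸ Finset.mem_insert_self _ _
      · have ha' := (Finset.mem_filter.1 ha).2
        rw [hf₂, Function.update_of_ne hai] at ha'
        exact Finset.mem_insert_of_mem (Finset.mem_filter.2 ⟨Finset.mem_univ a, ha'⟩)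
    have hlt : ∑ l, ((Finset.univ.filter fun a => f₂ a = l).card - m) <
        ∑ l, ((Finset.univ.filter fun a => f a = l).card - m) := by
      refine Finset.sum_lt_sum (fun l _ => ?_) ⟨j, Finset.mem_univ j, ?_⟩
      · by_cases hl : l = j'
        · subst hl
          have h1 := (Finset.card_le_card hsub').trans (Finset.card_insert_le _ _)
          omega
        · exact Nat.sub_le_sub_right
            ((Finset.card_le_card (hsub l hl)).trans (Finset.card_erase_le)) m
      · have h1 := Finset.card_le_card (hsub j hjj)
        rw [Finset.card_erase_of_mem hi] at h1
        omega
    obtain ⟨f', hf', hd⟩ := ih _ hlt f₂ rfl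
    refine ⟨f', hf', ?_⟩
    have h2 : (Finset.univ.filter fun a => f a ≠ f' a) ⊆
        insert i (Finset.univ.filter fun a => f₂ a ≠ f' a) := by
      intro a ha
      by_cases hai : a = i
      · exact hai ▸ Finset.mem_insert_self _ _
      · refine Finset.mem_insert_of_mem (Finset.mem_filter.2 ⟨Finset.mem_univ a, ?_⟩)
        rw [hf₂, Function.update_of_ne hai]
        exact (Finset.mem_filter.1 ha).2
    have h3 := (Finset.card_le_card h2).trans (Finset.card_insert_le _ _)
    omega

theorem exists_perm_comp_eq_of_card_fiber {n k : ℕ} {f f' : Fin n → Fin k}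
    (h : ∀ j, (Finset.univ.filter fun i => f i = j).card =
      (Finset.univ.filter fun i => f' i = j).card) :
    ∃ g : Equiv.Perm (Fin n), f ∘ g = f' := by
  have e : ∀ j, Nonempty ({i // f' i = j} ≃ {i // f i = j}) := fun j => by
    rw [← Fintype.card_eq, Fintype.card_subtype, Fintype.card_subtype, h]
  refine ⟨(Equiv.sigmaFiberEquiv f').symm.trans
    ((Equiv.sigmaCongrRight fun j => (e j).some).trans (Equiv.sigmaFiberEquiv f)),
    funext fun i => ?_⟩
  exact ((e (f' i)).some ⟨i, rfl⟩).2

/-- The squared fibre sizes sum to the number of ordered pairs on which `f` agrees: diagonal pairs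
always agree, the others with probability `1 / k`. -/
theorem expect_sum_sq_card_fiber {n k : ℕ} (hk : 0 < k) :
    𝔼 f : Fin n → Fin k, ∑ j, (((Finset.univ.filter fun i => f i = j).card : ℝ) - n / k) ^ 2 =
      n - n / k := by
  have hk0 : (k : ℝ) ≠ 0 := Nat.cast_ne_zero.2 hk.ne'
  have : Nonempty (Fin k) := ⟨⟨0, hk⟩⟩
  have hsum : ∀ f : Fin n → Fin k, ∑ j, ((Finset.univ.filter fun i => f i = j).card : ℝ) = n := by
    intro f
    rw [← Nat.cast_sum, ← Finset.card_eq_sum_card_fiberwise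
      (fun i _ => Finset.mem_coe.2 (Finset.mem_univ (f i)))]
    simp
  have hsq : ∀ f : Fin n → Fin k, ∑ j, ((Finset.univ.filter fun i => f i = j).card : ℝ) ^ 2 =
      ∑ i, ∑ i', if f i = f i' then (1 : ℝ) else 0 := by
    intro f
    have h1 : ∀ j, ((Finset.univ.filter fun i => f i = j).card : ℝ) =
        ∑ i, if f i = j then (1 : ℝ) else 0 := fun j => by simp
    simp only [h1, sq, Finset.sum_mul_sum]
    rw [Finset.sum_comm]
    refine Finset.sum_congr rfl fun i _ => ?_
    rw [Finset.sum_comm]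
    refine Finset.sum_congr rfl fun i' _ => ?_
    simp [eq_comm]
  have h2 : ∀ f : Fin n → Fin k,
      ∑ j, (((Finset.univ.filter fun i => f i = j).card : ℝ) - n / k) ^ 2 =
        ∑ i, ∑ i', (if f i = f i' then (1 : ℝ) else 0) - n ^ 2 / k := by
    intro f
    simp only [sub_sq, Finset.sum_add_distrib, Finset.sum_sub_distrib, hsq, ← Finset.sum_mul,
      ← Finset.mul_sum, hsum, Finset.sum_const, Finset.card_univ, Fintype.card_fin, nsmul_eq_mul]
    field_simp
    ring
  have h3 : ∀ i i' : Fin n, 𝔼 f : Fin n → Fin k, (if f i = f i' then (1 : ℝ) else 0) =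
      (k : ℝ)⁻¹ + if i = i' then 1 - (k : ℝ)⁻¹ else 0 := by
    intro i i'
    split_ifs with h
    · subst h
      simp
    · rw [expect_ite_apply_eq hk h, add_zero]
  simp only [h2]
  rw [Finset.expect_sub_distrib, Finset.expect_sum_comm]
  simp only [Finset.expect_sum_comm, h3, Finset.sum_add_distrib, Finset.sum_const,
    Finset.card_univ, Fintype.card_fin, nsmul_eq_mul, Finset.sum_ite_eq, Finset.mem_univ, if_true,
    Fintype.expect_const]
  field_simp
  ring

/-- Cauchy–Schwarz over `f` and over the `k` fibres reduces this to the variance, `k * (n - n / k) =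
n * (k - 1)`. -/
theorem expect_sum_abs_card_fiber_le {n k : ℕ} (hk : 0 < k) :
    𝔼 f : Fin n → Fin k, ∑ j, |((Finset.univ.filter fun i => f i = j).card : ℝ) - n / k| ≤
      Real.sqrt (n * (k - 1)) := by
  have : Nonempty (Fin k) := ⟨⟨0, hk⟩⟩
  have hk0 : (k : ℝ) ≠ 0 := Nat.cast_ne_zero.2 hk.ne'
  refine Real.le_sqrt_of_sq_le ?_
  set X : (Fin n → Fin k) → ℝ :=
    fun f => ∑ j, |((Finset.univ.filter fun i => f i = j).card : ℝ) - n / k| with hX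
  have h1 : (𝔼 f, X f) ^ 2 ≤ 𝔼 f, X f ^ 2 := by
    have := Finset.expect_mul_sq_le_sq_mul_sq Finset.univ X fun _ => 1
    simpa using this
  have h2 : ∀ f, X f ^ 2 ≤
      k * ∑ j, (((Finset.univ.filter fun i => f i = j).card : ℝ) - n / k) ^ 2 := by
    intro f
    have := sq_sum_le_card_mul_sum_sq (s := (Finset.univ : Finset (Fin k)))
      (f := fun j => |((Finset.univ.filter fun i => f i = j).card : ℝ) - n / k|)
    simpa [sq_abs] using this
  refine h1.trans ((Finset.expect_le_expect fun f _ => h2 f).trans (le_of_eq ?_))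
  rw [← Finset.mul_expect, expect_sum_sq_card_fiber hk]
  field_simp

/-- A coupling of the uniform distribution on maps `[n] → [k]` with the one on balanced maps. -/
theorem exists_balanced_coupling (F : Construction) {k n : ℕ+} (h : (k : ℕ) ∣ n) :
    ∃ β : (Fin n → Fin k) → Fin n → Fin k,
      (∀ (q : F.V k → ℝ) (x : F.V n), 𝔼 f : Fin n → Fin k, q (F.push f x) - symTo F .D n q x =
        𝔼 f : Fin n → Fin k, 𝔼 g : Equiv.Perm (Fin n),
          (q (F.push (f ∘ g) x) - q (F.push (β f ∘ g) x))) ∧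
      ∀ i : Fin n, 𝔼 f : Fin n → Fin k, 𝔼 g : Equiv.Perm (Fin n),
        (if f (g i) = β f (g i) then (0 : ℝ) else 1) ≤
          Real.sqrt ((k : ℝ) * ((k : ℝ) - 1) / ((n : ℝ) / k)) := by
  have hk0 : (0 : ℝ) < k := Nat.cast_pos.2 k.pos
  have hn0 : (0 : ℝ) < n := Nat.cast_pos.2 n.pos
  have hk1 : (1 : ℝ) ≤ k := Nat.one_le_cast.2 k.pos
  obtain ⟨m, hm⟩ := id h
  have hmk : (m : ℝ) = n / k := by
    rw [hm, Nat.cast_mul, mul_div_cancel_left₀ _ hk0.ne']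
  choose β hβ hd using fun f => exists_balanced hm f
  refine ⟨β, fun q x => ?_, fun i => ?_⟩
  · obtain ⟨c, hc⟩ := uniformFibers_blk h
    have hcm : c = m := by
      have h1 : (n : ℕ) = k * c := by
        have := Finset.card_eq_sum_card_fiberwise (s := (Finset.univ : Finset (Fin n)))
          (t := (Finset.univ : Finset (Fin k))) (f := blk h)
          (fun i _ => Finset.mem_coe.2 (Finset.mem_univ _))
        simpa [hc] using this
      exact Nat.eq_of_mul_eq_mul_left k.pos (h1.symm.trans hm)
    -- All balanced maps are rearrangements of the block map, so whichever one `f` is coupled to,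
    -- the permutation average is `symTo`.
    have hsym : ∀ f, 𝔼 g : Equiv.Perm (Fin n), q (F.push (β f ∘ g) x) = symTo F .D n q x := by
      intro f
      obtain ⟨g', hg'⟩ := exists_perm_comp_eq_of_card_fiber (f := blk h) (f' := β f)
        fun j => by rw [hβ, hc, hcm]
      rw [symTo_eq]
      refine Fintype.expect_equiv ((Equiv.mulLeft g').trans (Equiv.inv _)) _ _ fun g => ?_
      rw [proj_D F h, ← F.push_perm, F.push_push, ← hg']
      simp only [Equiv.trans_apply, Equiv.coe_mulLeft, Equiv.inv_apply, inv_inv]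
      rfl
    have hmean : ∀ g : Equiv.Perm (Fin n), 𝔼 f : Fin n → Fin k, q (F.push (f ∘ g) x) =
        𝔼 f : Fin n → Fin k, q (F.push f x) := fun g =>
      (uniformFibers_restrict (n := k) g.injective).expect_comp fun f => q (F.push f x)
    simp only [Finset.expect_sub_distrib, hsym, Fintype.expect_const]
    rw [Finset.expect_comm]
    simp only [hmean, Fintype.expect_const]
  · have h1 : ∀ f : Fin n → Fin k, 𝔼 g : Equiv.Perm (Fin n),
        (if f (g i) = β f (g i) then (0 : ℝ) else 1) ≤
          (∑ j, |((Finset.univ.filter fun i => f i = j).card : ℝ) - (n : ℕ) / (k : ℕ)|) / n := by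
      intro f
      -- The random permutation spreads the changes evenly, so each position changes with
      -- probability (number of changes) `/ n`.
      rw [expect_perm_apply i fun j => if f j = β f j then (0 : ℝ) else 1,
        Fintype.expect_eq_sum_div_card, Fintype.card_fin]
      refine div_le_div_of_nonneg_right ?_ hn0.le
      have e : ∑ j, (if f j = β f j then (0 : ℝ) else 1) =
          (Finset.univ.filter fun j => f j ≠ β f j).card := by
        rw [Finset.card_filter, Nat.cast_sum]
        refine Finset.sum_congr rfl fun j _ => ?_
        by_cases hj : f j = β f j
        · rw [if_pos hj, if_neg (not_not.2 hj), Nat.cast_zero]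
        · rw [if_neg hj, if_pos hj, Nat.cast_one]
      rw [e]
      refine (Nat.cast_le.2 (hd f)).trans ?_
      rw [Nat.cast_sum]
      refine Finset.sum_le_sum fun j _ => ?_
      rw [← hmk]
      rcases le_total ((Finset.univ.filter fun i => f i = j).card) m with hle | hle
      · rw [Nat.sub_eq_zero_of_le hle, Nat.cast_zero]
        exact abs_nonneg _
      · rw [Nat.cast_sub hle]
        exact le_abs_self _
    refine (Finset.expect_le_expect fun f _ => h1 f).trans ?_
    rw [← Finset.expect_div]
    refine (div_le_div_of_nonneg_right (expect_sum_abs_card_fiber_le k.pos) hn0.le).trans ?_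
    refine Real.le_sqrt_of_sq_le ?_
    rw [div_pow, Real.sq_sqrt (mul_nonneg hn0.le (sub_nonneg.2 hk1)), div_div_eq_mul_div,
      div_le_div_iff₀ (by positivity) hn0]
    -- What was obtained is `√((k - 1) / n)`; the stated bound is larger by a factor `k`.
    have h2 : (1 : ℝ) ≤ (k : ℝ) ^ 2 := one_le_pow₀ hk1
    have h3 : 0 ≤ (n : ℝ) ^ 2 * ((k : ℝ) - 1) := mul_nonneg (by positivity) (sub_nonneg.2 hk1)
    nlinarith [mul_le_mul_of_nonneg_left h2 h3]

/-! ## The `ℓ¹` norm and its dual -/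

theorem norm_le_norm1 (F : Construction) {n : ℕ} (v : F.V n) : ‖v‖ ≤ F.norm1 v := by
  rw [Submodule.coe_norm, EuclideanSpace.norm_eq]
  refine Real.sqrt_le_iff.2 ⟨Finset.sum_nonneg fun _ _ => abs_nonneg _, ?_⟩
  exact Finset.sum_sq_le_sq_sum_of_nonneg fun _ _ => norm_nonneg _

theorem norm1_nonneg (F : Construction) {n : ℕ} (v : F.V n) : 0 ≤ F.norm1 v :=
  Finset.sum_nonneg fun _ _ => abs_nonneg _

theorem norm1_smul (F : Construction) {n : ℕ} (c : ℝ) (v : F.V n) :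
    F.norm1 (c • v) = |c| * F.norm1 v := by
  simp [Construction.norm1, abs_mul, Finset.mul_sum]

theorem continuous_norm1 (F : Construction) (n : ℕ) : Continuous fun v : F.V n => F.norm1 v :=
  continuous_finsetSum _ fun a _ =>
    ((PiLp.continuous_apply 2 _ a).comp continuous_subtype_val).abs

theorem abs_apply_le_norm_of_norm1_le (F : Construction) {n : ℕ} (φ : F.V n →L[ℝ] ℝ) {r : ℝ}
    (hr : r ∈ {r : ℝ | ∃ v : F.V n, F.norm1 v ≤ 1 ∧ r = |φ v|}) : r ≤ ‖φ‖ := by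
  obtain ⟨v, hv, rfl⟩ := hr
  exact (φ.le_opNorm v).trans
    (mul_le_of_le_one_right φ.opNorm_nonneg ((norm_le_norm1 F v).trans hv))

theorem dualNorm_nonneg (F : Construction) {n : ℕ} (φ : F.V n →L[ℝ] ℝ) : 0 ≤ F.dualNorm φ :=
  Real.sSup_nonneg fun _ ⟨_, _, hr⟩ => hr ▸ abs_nonneg _

theorem dualNorm_le (F : Construction) {n : ℕ} {φ : F.V n →L[ℝ] ℝ} {B : ℝ} (hB : 0 ≤ B)
    (h : ∀ v, |φ v| ≤ B * ‖v‖) : F.dualNorm φ ≤ B := by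
  refine Real.sSup_le ?_ hB
  rintro _ ⟨v, hv, rfl⟩
  exact (h v).trans (mul_le_of_le_one_right hB ((norm_le_norm1 F v).trans hv))

theorem abs_apply_le_dualNorm (F : Construction) {n : ℕ} (φ : F.V n →L[ℝ] ℝ) (v : F.V n) :
    |φ v| ≤ F.dualNorm φ * F.norm1 v := by
  rcases (norm1_nonneg F v).eq_or_lt with h | h
  · have hv : v = 0 := norm_le_zero_iff.1 (h ▸ norm_le_norm1 F v)
    rw [hv, map_zero, abs_zero]
    exact mul_nonneg (dualNorm_nonneg F φ) (norm1_nonneg F _)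
  · have h1 : |φ ((F.norm1 v)⁻¹ • v)| ≤ F.dualNorm φ := by
      refine le_csSup ⟨‖φ‖, fun r hr => abs_apply_le_norm_of_norm1_le F φ hr⟩ ⟨_, ?_, rfl⟩
      rw [norm1_smul, abs_of_pos (inv_pos.2 h), inv_mul_cancel₀ h.ne']
    rw [map_smul, smul_eq_mul, abs_mul, abs_of_pos (inv_pos.2 h), inv_mul_le_iff₀ h] at h1
    linarith

theorem contDiff_of_mem_polys {F : Construction} {n d : ℕ} {p : F.V n → ℝ}
    (hp : p ∈ polys F n d) : ContDiff ℝ 1 p := by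
  refine polys_induction F (P := fun p => ContDiff ℝ 1 p) contDiff_const
    (fun _ _ h h' => h.add h') (fun c _ h => contDiff_const.smul h) (fun e _ a => ?_) hp
  refine contDiff_prod fun i _ => ?_
  exact ((EuclideanSpace.proj (𝕜 := ℝ) (a i)).comp (Submodule.subtypeL (F.V n))).contDiff

theorem exists_abs_fderiv_apply_le {E : Type*} [NormedAddCommGroup E] [NormedSpace ℝ E]
    [FiniteDimensional ℝ E] {q : E → ℝ} (hq : ContDiff ℝ 1 q) {S : Set E}
    (hS : Bornology.IsBounded S) :
    ∃ B, 0 ≤ B ∧ ∀ z ∈ S, ∀ v, |fderiv ℝ q z v| ≤ B * ‖v‖ := by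
  have : ProperSpace E := FiniteDimensional.proper ℝ _
  obtain ⟨B, hB⟩ := hS.isCompact_closure.exists_bound_of_continuousOn
    (hq.continuous_fderiv one_ne_zero).continuousOn
  refine ⟨|B|, abs_nonneg _, fun z hz v => ((fderiv ℝ q z).le_opNorm v).trans ?_⟩
  exact mul_le_mul_of_nonneg_right ((hB z (subset_closure hz)).trans (le_abs_self _))
    (norm_nonneg _)

theorem sub_le_gradNorm_mul {F : Construction} {n d : ℕ} {S : Set (F.V n)}
    (hS : Bornology.IsBounded S) {q : F.V n → ℝ} (hq : q ∈ polys F n d) {x y : F.V n}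
    (hx : x ∈ S) (hy : y ∈ S) :
    q y - q x ≤ gradNorm F (convexHull ℝ S) q * F.norm1 (y - x) := by
  have hcd := contDiff_of_mem_polys hq
  have hdiff : Differentiable ℝ q := hcd.differentiable one_ne_zero
  obtain ⟨z, hz, e⟩ := domain_mvt (s := convexHull ℝ S) (f := q) (f' := fderiv ℝ q)
    (fun x _ => (hdiff x).hasFDerivAt.hasFDerivWithinAt) (convex_convexHull ℝ S)
    (subset_convexHull ℝ S hx) (subset_convexHull ℝ S hy)
  have hzS : z ∈ convexHull ℝ S := (convex_convexHull ℝ S).segment_subset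
    (subset_convexHull ℝ S hx) (subset_convexHull ℝ S hy) hz
  obtain ⟨B, hB0, hB⟩ := exists_abs_fderiv_apply_le hcd (isBounded_convexHull.2 hS)
  -- Needed because `sSup` of an unbounded set of reals is the default value `0`.
  have hbdd : BddAbove ((fun x => F.dualNorm (fderiv ℝ q x)) '' convexHull ℝ S) := by
    refine ⟨B, ?_⟩
    rintro _ ⟨w, hw, rfl⟩
    exact dualNorm_le F hB0 (hB w hw)
  rw [e]
  refine (le_abs_self _).trans ((abs_apply_le_dualNorm F _ _).trans ?_)
  exact mul_le_mul_of_nonneg_right (le_csSup hbdd ⟨z, hzS, rfl⟩) (norm1_nonneg F _)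

theorem gradNorm_nonneg (F : Construction) {n : ℕ} (S : Set (F.V n)) (q : F.V n → ℝ) :
    0 ≤ gradNorm F S q :=
  Real.sSup_nonneg fun _ ⟨_, _, hr⟩ => hr ▸ dualNorm_nonneg F _

/-! ## The effect of changing values of a map -/

theorem ite_relabel_eq_le (G : Construction) {m n : ℕ} (f f' : Fin m → Fin n) (a : G.Idx m) :
    (if G.relabel f a = G.relabel f' a then (0 : ℝ) else 1) ≤
      ∑ i ∈ G.support a, if f i = f' i then (0 : ℝ) else 1 := by
  have hnn : ∀ i, 0 ≤ if f i = f' i then (0 : ℝ) else 1 := fun i => by split_ifs <;> norm_num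
  split_ifs with h
  · exact Finset.sum_nonneg fun i _ => hnn i
  · obtain ⟨i, hi, hne⟩ : ∃ i ∈ G.support a, f i ≠ f' i := by
      by_contra hcon
      push Not at hcon
      exact h (G.relabel_congr hcon)
    refine le_trans (le_of_eq (if_neg hne).symm)
      (Finset.single_le_sum (f := fun i => if f i = f' i then (0 : ℝ) else 1)
        (fun i _ => hnn i) hi)

/-- An entry whose index is relabelled differently leaves one place and arrives at another, which
costs twice its absolute value; this requires a change somewhere on the support. -/
theorem norm1_push_sub_le (F : Construction) {m n : ℕ} (f f' : Fin m → Fin n) (x : F.V m) :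
    F.norm1 (F.push f x - F.push f' x) ≤
      ∑ a, 2 * |x.1 a| * ∑ i ∈ F.support a, if f i = f' i then (0 : ℝ) else 1 := by
  have h1 : ∀ b, |(F.push f x - F.push f' x).1 b| ≤
      ∑ a, |x.1 a| * |(if F.relabel f a = b then (1 : ℝ) else 0) -
        if F.relabel f' a = b then (1 : ℝ) else 0| := by
    intro b
    have e : (F.push f x - F.push f' x).1 b = ∑ a, x.1 a *
        ((if F.relabel f a = b then (1 : ℝ) else 0) -
          if F.relabel f' a = b then (1 : ℝ) else 0) := by
      refine (congrArg₂ (· - ·) (F.push_apply f x b) (F.push_apply f' x b)).trans ?_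
      simp only [← Finset.sum_sub_distrib, mul_sub, mul_ite, mul_one, mul_zero]
    rw [e]
    refine (Finset.abs_sum_le_sum_abs _ _).trans (le_of_eq ?_)
    simp only [abs_mul]
  refine (Finset.sum_le_sum fun b _ => h1 b).trans ?_
  rw [Finset.sum_comm]
  refine Finset.sum_le_sum fun a _ => ?_
  rw [← Finset.mul_sum, mul_comm 2, mul_assoc]
  refine mul_le_mul_of_nonneg_left ?_ (abs_nonneg _)
  refine le_trans ?_ (mul_le_mul_of_nonneg_left (ite_relabel_eq_le F f f' a) zero_le_two)
  split_ifs with h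
  · simp [h]
  · refine (Finset.sum_le_sum fun b _ => abs_sub _ _).trans (le_of_eq ?_)
    rw [Finset.sum_add_distrib]
    simp only [apply_ite abs, abs_one, abs_zero, Finset.sum_ite_eq, Finset.mem_univ, if_true]
    norm_num

theorem sum_support_expect_le (G : Construction) {k n : ℕ+} {β : (Fin n → Fin k) → Fin n → Fin k}
    {r : ℝ} (hβ : ∀ i : Fin n, 𝔼 f : Fin n → Fin k, 𝔼 g : Equiv.Perm (Fin n),
        (if f (g i) = β f (g i) then (0 : ℝ) else 1) ≤ r) (hr : 0 ≤ r) (a : G.Idx n) :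
    𝔼 f : Fin n → Fin k, 𝔼 g : Equiv.Perm (Fin n),
      ∑ i ∈ G.support a, (if (f ∘ g) i = (β f ∘ g) i then (0 : ℝ) else 1) ≤ G.deg * r := by
  simp only [Finset.expect_sum_comm]
  refine (Finset.sum_le_sum fun i _ => hβ i).trans ?_
  rw [Finset.sum_const, nsmul_eq_mul]
  exact mul_le_mul_of_nonneg_right (Nat.cast_le.2 (G.card_support_le a)) hr

/-! ## Rates for zero-padding costs -/

theorem expect_sub_symTo_D_le {F : Construction} {Ω : ∀ n : ℕ+, Set (F.V n)}
    (hΩ : FSCompatible F .Z Ω) (hcompact : ∀ n, IsCompact (Ω n)) {k n : ℕ+}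
    (h : (k : ℕ) ∣ n) {d : ℕ} {q : F.V k → ℝ} (hq : q ∈ polys F k d) {x : F.V n}
    (hx : x ∈ Ω n) :
    𝔼 f : Fin n → Fin k, q (F.push f x) - symTo F .D n q x ≤
      2 * (F.deg : ℝ) * Real.sqrt ((k : ℝ) * ((k : ℝ) - 1) / ((n : ℝ) / k)) *
        gradNorm F (convexHull ℝ (Ω k)) q * F.norm1 x := by
  obtain ⟨β, hβ, hr⟩ := exists_balanced_coupling F h
  set r := Real.sqrt ((k : ℝ) * ((k : ℝ) - 1) / ((n : ℝ) / k)) with hrdef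
  set G := gradNorm F (convexHull ℝ (Ω k)) q with hG
  have hG0 : 0 ≤ G := gradNorm_nonneg F _ _
  have hterm : ∀ (f : Fin n → Fin k) (g : Equiv.Perm (Fin n)),
      q (F.push (f ∘ g) x) - q (F.push (β f ∘ g) x) ≤
        ∑ a, G * (2 * |x.1 a|) *
          ∑ i ∈ F.support a, if (f ∘ g) i = (β f ∘ g) i then (0 : ℝ) else 1 := by
    intro f g
    refine (sub_le_gradNorm_mul (hcompact k).isBounded hq
      (hΩ.sampleMap_mem (U := .Z) (β f ∘ g) hx) (hΩ.sampleMap_mem (U := .Z) (f ∘ g) hx)).trans ?_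
    refine (mul_le_mul_of_nonneg_left (norm1_push_sub_le F _ _ x) hG0).trans (le_of_eq ?_)
    rw [Finset.mul_sum]
    exact Finset.sum_congr rfl fun a _ => (mul_assoc _ _ _).symm
  rw [hβ]
  refine (Finset.expect_le_expect fun f _ => Finset.expect_le_expect fun g _ => hterm f g).trans ?_
  simp only [Finset.expect_sum_comm (t := (Finset.univ : Finset (F.Idx n))), ← Finset.mul_expect]
  refine (Finset.sum_le_sum fun a _ => mul_le_mul_of_nonneg_left
    (sum_support_expect_le F hr (Real.sqrt_nonneg _) a) (by positivity)).trans (le_of_eq ?_)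
  rw [Construction.norm1, Finset.mul_sum]
  exact Finset.sum_congr rfl fun a _ => by ring

/-- Invariant combinations of monomials with small weights are uniformly small on
FS-compatible compact sets. -/
theorem exists_abs_sum_monom_le {F : Construction} {Ω : ∀ n : ℕ+, Set (F.V n)}
    (hΩ : FSCompatible F .Z Ω) (hcompact : ∀ n, IsCompact (Ω n)) (e : ℕ) :
    ∃ C : ℝ, 0 ≤ C ∧ ∀ (n : ℕ+) (w : (Construction.sym e F).Idx n → ℝ) (ε : ℝ), 0 ≤ ε →
      (∀ (g : Equiv.Perm (Fin n)) a, w ((Construction.sym e F).relabel g a) = w a) →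
      (∀ a, |w a| ≤ ε) → ∀ x ∈ Ω n, |∑ a, w a * monom F a x| ≤ C * ε := by
  set K : ℕ+ := ⟨(Construction.sym e F).deg + 1, Nat.succ_pos _⟩ with hK
  obtain ⟨C, hC0, hC⟩ := exists_coeff_push (.sym e F) K.pos (Nat.le_succ _)
  have hbound : ∀ b : (Construction.sym e F).Idx K, ∃ B, ∀ z ∈ Ω K, ‖monom F b z‖ ≤ B := fun b =>
    (hcompact K).exists_bound_of_continuousOn
      (continuous_of_mem_polys (monom_mem_polys F le_rfl b)).continuousOn
  choose B hB using hbound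
  refine ⟨∑ b, C * |B b|, Finset.sum_nonneg fun b _ => mul_nonneg hC0 (abs_nonneg _), ?_⟩
  intro n w ε hε0 hinv hε x hx
  obtain ⟨v, hv, hw⟩ := hC n w ε hε0 hinv hε
  -- The points `F.push f x` lie in the fixed compact set `Ω K`, and the number of monomials on the
  -- right does not depend on `n`.
  have h1 : ∑ a, w a * monom F a x = 𝔼 f : Fin n → Fin K, ∑ b, v b * monom F b (F.push f x) := by
    simp only [sum_mul_monom_push, hw]
    rw [Finset.expect_sum_comm]
    exact Finset.sum_congr rfl fun a _ => Finset.expect_mul _ _ _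
  rw [h1]
  refine (Finset.abs_expect_le _ _).trans (Finset.expect_le Finset.univ_nonempty fun f _ => ?_)
  refine (Finset.abs_sum_le_sum_abs _ _).trans ?_
  rw [Finset.sum_mul]
  refine Finset.sum_le_sum fun b _ => ?_
  rw [abs_mul, mul_right_comm]
  exact mul_le_mul (hv b) ((hB b _ (hΩ.sampleMap_mem (U := .Z) f hx)).trans (le_abs_self _))
    (abs_nonneg _) (mul_nonneg hC0 hε0)

/-- The weight of an index `a` is the difference of the probabilities that a uniform and the coupled
balanced map relabel `a` to `b`. It is at most the probability that the two relabellings differ, and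
it is invariant because a uniform permutation is composed in. -/
theorem exists_abs_expect_sub_symTo_D_monom_le {F : Construction} {Ω : ∀ n : ℕ+, Set (F.V n)}
    (hΩ : FSCompatible F .Z Ω) (hcompact : ∀ n, IsCompact (Ω n)) {k : ℕ+} {e : ℕ}
    (b : (Construction.sym e F).Idx k) :
    ∃ C : ℝ, ∀ n : ℕ+, (k : ℕ) ∣ n → ∀ x ∈ Ω n,
      |𝔼 f : Fin n → Fin k, monom F b (F.push f x) - symTo F .D n (monom F b) x| ≤
        C * Real.sqrt ((k : ℝ) * ((k : ℝ) - 1) / ((n : ℝ) / k)) := by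
  obtain ⟨C, hC0, hC⟩ := exists_abs_sum_monom_le hΩ hcompact e
  refine ⟨C * (Construction.sym e F).deg, fun n h x hx => ?_⟩
  obtain ⟨β, hβ, hr⟩ := exists_balanced_coupling F h
  set r := Real.sqrt ((k : ℝ) * ((k : ℝ) - 1) / ((n : ℝ) / k)) with hrdef
  have hr0 : 0 ≤ r := Real.sqrt_nonneg _
  set w : (Construction.sym e F).Idx n → ℝ := fun a => 𝔼 f : Fin n → Fin k,
    𝔼 g : Equiv.Perm (Fin n), ((if (Construction.sym e F).relabel (f ∘ g) a = b then (1 : ℝ) else 0)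
      - if (Construction.sym e F).relabel (β f ∘ g) a = b then (1 : ℝ) else 0) with hw
  have h1 : 𝔼 f : Fin n → Fin k, monom F b (F.push f x) - symTo F .D n (monom F b) x =
      ∑ a, w a * monom F a x := by
    rw [hβ]
    simp only [hw, Finset.expect_mul, ← Finset.expect_sum_comm]
    refine Finset.expect_congr rfl fun f _ => Finset.expect_congr rfl fun g _ => ?_
    rw [monom_push, monom_push, ← Finset.sum_sub_distrib]
    refine Finset.sum_congr rfl fun a _ => ?_
    rw [sub_mul, ite_mul, ite_mul, one_mul, zero_mul]
  rw [h1, mul_assoc]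
  refine hC n w _ (by positivity) (fun g' a => ?_) (fun a => ?_) x hx
  · refine Finset.expect_congr rfl fun f _ => ?_
    refine Fintype.expect_equiv (Equiv.mulRight g') _ _ fun g => ?_
    rw [Construction.relabel_relabel, Construction.relabel_relabel]
    rfl
  · refine le_trans ?_ (sum_support_expect_le (.sym e F) hr hr0 a)
    refine (Finset.abs_expect_le _ _).trans (Finset.expect_le_expect fun f _ => ?_)
    refine (Finset.abs_expect_le _ _).trans (Finset.expect_le_expect fun g _ => ?_)
    refine le_trans ?_ (ite_relabel_eq_le _ _ _ a)
    split_ifs <;> simp_all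

theorem exists_abs_expect_sub_symTo_D_le {F : Construction} {Ω : ∀ n : ℕ+, Set (F.V n)}
    (hΩ : FSCompatible F .Z Ω) (hcompact : ∀ n, IsCompact (Ω n)) {k : ℕ+} {d : ℕ}
    {q : F.V k → ℝ} (hq : q ∈ polys F k d) :
    ∃ C : ℝ, ∀ n : ℕ+, (k : ℕ) ∣ n → ∀ x ∈ Ω n,
      |𝔼 f : Fin n → Fin k, q (F.push f x) - symTo F .D n q x| ≤
        C * Real.sqrt ((k : ℝ) * ((k : ℝ) - 1) / ((n : ℝ) / k)) := by
  refine polys_induction F (P := fun q => ∃ C : ℝ, ∀ n : ℕ+, (k : ℕ) ∣ n → ∀ x ∈ Ω n,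
      |𝔼 f : Fin n → Fin k, q (F.push f x) - symTo F .D n q x| ≤
        C * Real.sqrt ((k : ℝ) * ((k : ℝ) - 1) / ((n : ℝ) / k))) ?_ ?_ ?_ ?_ hq
  · exact ⟨0, fun n _ x _ => by simp [symTo]⟩
  · rintro q q' ⟨C, hC⟩ ⟨C', hC'⟩
    refine ⟨C + C', fun n h x hx => ?_⟩
    have e : 𝔼 f : Fin n → Fin k, (q + q') (F.push f x) - symTo F .D n (q + q') x =
        (𝔼 f : Fin n → Fin k, q (F.push f x) - symTo F .D n q x) +
          (𝔼 f : Fin n → Fin k, q' (F.push f x) - symTo F .D n q' x) := by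
      simp only [symTo_eq, Pi.add_apply, Finset.expect_add_distrib]
      ring
    rw [e, add_mul]
    exact (abs_add_le _ _).trans (add_le_add (hC n h x hx) (hC' n h x hx))
  · rintro c q ⟨C, hC⟩
    refine ⟨|c| * C, fun n h x hx => ?_⟩
    have e : 𝔼 f : Fin n → Fin k, (c • q) (F.push f x) - symTo F .D n (c • q) x =
        c * (𝔼 f : Fin n → Fin k, q (F.push f x) - symTo F .D n q x) := by
      simp only [symTo_eq, Pi.smul_apply, smul_eq_mul, ← Finset.mul_expect]
      ring
    rw [e, abs_mul, mul_assoc]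
    exact mul_le_mul_of_nonneg_left (hC n h x hx) (abs_nonneg _)
  · exact fun e _ b => exists_abs_expect_sub_symTo_D_monom_le hΩ hcompact b

/-! ## The limiting optimal value -/

theorem isGLB_integral {F : Construction} {U : BaseSeq}
    {Ω : ∀ n : ℕ+, Set (F.V n)} (hΩ : FSCompatible F U Ω)
    (hcompact : ∀ n, IsCompact (Ω n)) (hne : ∀ n, (Ω n).Nonempty)
    {p : ∀ n : ℕ+, F.V n → ℝ} {uInf : ℝ}
    (hu : IsGLB (Set.range fun n => optVal (Ω n) (p n)) uInf)
    (hpc : ∀ n, Continuous (p n)) {k : ℕ+} {q : F.V k → ℝ} (hq : IsDualCost F U p q)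
    (hl : IsLUB {r : ℝ | ∃ n : ℕ+, U.opp.Prec k n ∧
      r = optVal (Ω n) (symTo F U.opp n q)} uInf) :
    IsGLB {r : ℝ | ∃ μ : ∀ n : ℕ+, Measure (F.V n),
      FreelyDescribedMeasure F U.opp Ω μ ∧ r = ∫ x, q x ∂μ k} uInf := by
  constructor
  · rintro _ ⟨μ, hμ, rfl⟩
    refine hl.2 ?_
    rintro _ ⟨n, hn, rfl⟩
    exact hμ.optVal_le_integral hcompact hn hq.continuous
  · intro b hb
    refine hu.2 ?_
    rintro _ ⟨n, rfl⟩
    obtain ⟨x, hx, e⟩ := exists_optVal_eq (hcompact n) (hne n) (hpc n)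
    refine hb ⟨_, freelyDescribedMeasure_sampleLaw hΩ hcompact hx, ?_⟩
    rw [integral_sampleLaw, ← hq.eq_expect]
    exact e

/-- As `uInf` separates `l` from `u`, a gap tending to zero along a single sequence of dimensions
suffices. -/
theorem isLUB_of_rate {B : BaseSeq} {k : ℕ+} {u l : ℕ+ → ℝ} {uInf : ℝ}
    (hu : ∀ n, uInf ≤ u n) (hl : ∀ n, B.Prec k n → l n ≤ uInf) {s : ℕ → ℕ+}
    (hs : ∀ j, B.Prec k (s j)) {δ : ℕ → ℝ} (hδ : Filter.Tendsto δ Filter.atTop (nhds 0))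
    (h : ∀ j, u (s j) - l (s j) ≤ δ j) :
    IsLUB {r : ℝ | ∃ n : ℕ+, B.Prec k n ∧ r = l n} uInf := by
  constructor
  · rintro _ ⟨n, hn, rfl⟩
    exact hl n hn
  · intro b hb
    have h1 : ∀ j, uInf - b ≤ δ j := fun j => by
      have := hb ⟨s j, hs j, rfl⟩
      linarith [hu (s j), h j]
    exact sub_nonpos.1 (ge_of_tendsto' hδ h1)

end FSPair

end

/-! ### The main theorem -/

theorem mainTheorem1 (F : FSPair.Construction) (U : FSPair.BaseSeq)
    (Ω : ∀ n : ℕ+, Set (F.V n)) (hΩ : FSPair.FSCompatible F U Ω)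
    (hcompact : ∀ n, IsCompact (Ω n)) (hne : ∀ n, (Ω n).Nonempty)
    (d : ℕ) (p : ∀ n : ℕ+, F.V n → ℝ) (hp : FSPair.FreelyDescribed F U d p)
    (u : ℕ+ → ℝ) (hu : ∀ n, u n = FSPair.optVal (Ω n) (p n))
    (uInf : ℝ) (huInf : uInf = ⨅ n, u n) :
    -- existence of the dual cost
    (∃ (k : ℕ+) (q : F.V k → ℝ), FSPair.IsPolynomial F d q ∧ FSPair.IsInvariant F q ∧
      FSPair.IsDualCost F U p q) ∧
    -- uniqueness of the dual cost as a freely-symmetrized element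
    (∀ (k₁ k₂ : ℕ+) (q₁ : F.V k₁ → ℝ) (q₂ : F.V k₂ → ℝ),
      FSPair.IsDualCost F U p q₁ → FSPair.IsDualCost F U p q₂ →
      ∀ n : ℕ+, U.opp.Prec k₁ n → U.opp.Prec k₂ n →
        FSPair.symTo F U.opp n q₁ = FSPair.symTo F U.opp n q₂) ∧
    -- the limiting optimal value is finite
    IsGLB (Set.range u) uInf ∧
    ∀ (k : ℕ+) (q : F.V k → ℝ), FSPair.IsDualCost F U p q →
      ∀ l : ℕ+ → ℝ, (∀ n, l n = FSPair.optVal (Ω n) (FSPair.symTo F U.opp n q)) →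
        -- reformulation over freely-described measures
        IsGLB {r : ℝ | ∃ μ : ∀ n : ℕ+, MeasureTheory.Measure (F.V n),
          FSPair.FreelyDescribedMeasure F U.opp Ω μ ∧ r = ∫ x, q x ∂μ k} uInf ∧
        -- monotone lower bounds
        (∀ n N : ℕ+, U.opp.Prec k n → U.opp.Prec n N → l n ≤ l N ∧ l N ≤ uInf) ∧
        -- convergence
        IsLUB {r : ℝ | ∃ n : ℕ+, U.opp.Prec k n ∧ r = l n} uInf ∧
        -- first rate
        (U = FSPair.BaseSeq.D → ∀ n : ℕ+, k ≤ n →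
          u n - l n ≤ ((k : ℝ) * ((k : ℝ) - 1)) / (n : ℝ) * FSPair.supNorm (Ω k) q) ∧
        -- second rate, with an explicit constant
        (U = FSPair.BaseSeq.Z → ∀ n : ℕ+, (k : ℕ) ∣ (n : ℕ) →
          u n - l n ≤ 2 * (F.deg : ℝ) *
            Real.sqrt (((k : ℝ) * ((k : ℝ) - 1)) / ((n : ℝ) / (k : ℝ))) *
            FSPair.gradNorm F (convexHull ℝ (Ω k)) q * sSup (F.norm1 '' Ω n)) ∧
        -- second rate, uniformly in the dimension
        (U = FSPair.BaseSeq.Z → ∃ C : ℝ, ∀ n : ℕ+, (k : ℕ) ∣ (n : ℕ) →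
          u n - l n ≤ C * Real.sqrt (((k : ℝ) * ((k : ℝ) - 1)) / ((n : ℝ) / (k : ℝ)))) := by
  obtain rfl : u = fun n => FSPair.optVal (Ω n) (p n) := funext hu
  have hpc : ∀ n, Continuous (p n) := fun n => FSPair.continuous_of_mem_polys (hp.polynomial n)
  have hrefl : ∀ k : ℕ+, U.opp.Prec k k := fun k => by
    cases U
    · exact dvd_refl (k : ℕ)
    · exact le_refl k
  obtain ⟨k₀, q₀, hd₀, hinv₀, hq₀⟩ := FSPair.exists_dualCost hp
  have hglb : IsGLB (Set.range fun n => FSPair.optVal (Ω n) (p n)) uInf := by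
    rw [huInf]
    -- Any single symmetrized lower bound shows that the optimal values are bounded below, so the
    -- infimum is genuine.
    refine isGLB_ciInf ⟨FSPair.optVal (Ω k₀) (FSPair.symTo F U.opp k₀ q₀), ?_⟩
    rintro _ ⟨n, rfl⟩
    exact FSPair.optVal_symTo_le hΩ hcompact hne hq₀ (hrefl k₀) n
  refine ⟨⟨k₀, q₀, hd₀, hinv₀, hq₀⟩, fun k₁ k₂ q₁ q₂ h₁ h₂ n hk₁ hk₂ =>
    h₁.symTo_eq_symTo h₂ hk₁ hk₂, hglb, fun k q hq l hl => ?_⟩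
  obtain rfl : l = fun n => FSPair.optVal (Ω n) (FSPair.symTo F U.opp n q) := funext hl
  have hle : ∀ n, U.opp.Prec k n →
      FSPair.optVal (Ω n) (FSPair.symTo F U.opp n q) ≤ uInf := fun n hn => by
    refine hglb.2 ?_
    rintro _ ⟨m, rfl⟩
    exact FSPair.optVal_symTo_le hΩ hcompact hne hq hn m
  have hsub : ∀ (n : ℕ+) (c : ℝ), (∀ x ∈ Ω n, p n x - FSPair.symTo F U.opp n q x ≤ c) →
      FSPair.optVal (Ω n) (p n) - FSPair.optVal (Ω n) (FSPair.symTo F U.opp n q) ≤ c :=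
    fun n c h => FSPair.optVal_sub_optVal_le (hcompact n) (hne n) (hpc n)
      (FSPair.continuous_symTo F _ hq.continuous) h
  obtain ⟨d', hd'⟩ := hq.1
  have hrate₁ : U = FSPair.BaseSeq.D → ∀ n : ℕ+, k ≤ n →
      FSPair.optVal (Ω n) (p n) - FSPair.optVal (Ω n) (FSPair.symTo F U.opp n q) ≤
        ((k : ℝ) * ((k : ℝ) - 1)) / (n : ℝ) * FSPair.supNorm (Ω k) q := by
    rintro rfl n hkn
    refine hsub n _ fun x hx => ?_
    rw [hq.eq_expect]
    refine FSPair.expect_sub_symTo_Z_le F hkn q x fun f => ?_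
    exact le_csSup ((hcompact k).image hq.continuous.abs).bddAbove
      ⟨_, hΩ.sampleMap_mem (U := .D) f hx, rfl⟩
  have hrate₂ : U = FSPair.BaseSeq.Z → ∀ n : ℕ+, (k : ℕ) ∣ (n : ℕ) →
      FSPair.optVal (Ω n) (p n) - FSPair.optVal (Ω n) (FSPair.symTo F U.opp n q) ≤
        2 * (F.deg : ℝ) * Real.sqrt (((k : ℝ) * ((k : ℝ) - 1)) / ((n : ℝ) / (k : ℝ))) *
          FSPair.gradNorm F (convexHull ℝ (Ω k)) q * sSup (F.norm1 '' Ω n) := by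
    rintro rfl n hkn
    refine hsub n _ fun x hx => ?_
    rw [hq.eq_expect]
    refine (FSPair.expect_sub_symTo_D_le hΩ hcompact hkn hd' hx).trans ?_
    have hG := FSPair.gradNorm_nonneg F (convexHull ℝ (Ω k)) q
    refine mul_le_mul_of_nonneg_left ?_ (by positivity)
    exact le_csSup ((hcompact n).image (FSPair.continuous_norm1 F n)).bddAbove ⟨x, hx, rfl⟩
  have hrate₃ : U = FSPair.BaseSeq.Z → ∃ C : ℝ, ∀ n : ℕ+, (k : ℕ) ∣ (n : ℕ) →
      FSPair.optVal (Ω n) (p n) - FSPair.optVal (Ω n) (FSPair.symTo F U.opp n q) ≤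
        C * Real.sqrt (((k : ℝ) * ((k : ℝ) - 1)) / ((n : ℝ) / (k : ℝ))) := by
    rintro rfl
    obtain ⟨C, hC⟩ := FSPair.exists_abs_expect_sub_symTo_D_le hΩ hcompact hd'
    refine ⟨C, fun n hkn => hsub n _ fun x hx => ?_⟩
    rw [hq.eq_expect]
    exact (le_abs_self _).trans (hC n hkn x hx)
  have hkpos : (0 : ℝ) < k := Nat.cast_pos.2 k.pos
  have hlub : IsLUB {r : ℝ | ∃ n : ℕ+, U.opp.Prec k n ∧
      r = FSPair.optVal (Ω n) (FSPair.symTo F U.opp n q)} uInf := by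
    have hinvlim : Filter.Tendsto (fun j : ℕ => ((j : ℝ) + 1)⁻¹) Filter.atTop (nhds 0) := by
      simpa using tendsto_one_div_add_atTop_nhds_zero_nat (𝕜 := ℝ)
    -- The multiples `k * (j + 1)` are admissible dimensions for both orders, and along them either
    -- rate tends to zero.
    have hs : ∀ j : ℕ, ((k * j.succPNat : ℕ+) : ℝ) = k * (j + 1) := fun j => by
      push_cast
      simp
    cases U
    · obtain ⟨C, hC⟩ := hrate₃ rfl
      refine FSPair.isLUB_of_rate (u := fun n => FSPair.optVal (Ω n) (p n))
        (fun n => hglb.1 ⟨n, rfl⟩) hle (s := fun j => k * j.succPNat)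
        (fun j => Dvd.intro _ rfl)
        (δ := fun j => C * Real.sqrt ((k : ℝ) * ((k : ℝ) - 1) * ((j : ℝ) + 1)⁻¹)) ?_ fun j => ?_
      · simpa using (((hinvlim.const_mul ((k : ℝ) * ((k : ℝ) - 1))).sqrt).const_mul C)
      · refine (hC (k * j.succPNat) (Dvd.intro _ rfl)).trans (le_of_eq ?_)
        rw [hs, mul_div_cancel_left₀ _ hkpos.ne', div_eq_mul_inv]
    · refine FSPair.isLUB_of_rate (u := fun n => FSPair.optVal (Ω n) (p n))
        (fun n => hglb.1 ⟨n, rfl⟩) hle (s := fun j => k * j.succPNat)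
        (fun j => Nat.le_mul_of_pos_right _ j.succPNat.pos)
        (δ := fun j => ((k : ℝ) - 1) * FSPair.supNorm (Ω k) q * ((j : ℝ) + 1)⁻¹) ?_ fun j => ?_
      · simpa using hinvlim.const_mul (((k : ℝ) - 1) * FSPair.supNorm (Ω k) q)
      · refine (hrate₁ rfl (k * j.succPNat)
          (Nat.le_mul_of_pos_right _ j.succPNat.pos)).trans (le_of_eq ?_)
        rw [hs]
        field_simp
  exact ⟨FSPair.isGLB_integral hΩ hcompact hne hglb hpc hq hlub,
    fun n N hkn hnN => ⟨FSPair.optVal_symTo_mono hΩ hcompact hne hkn hnN hq.continuous,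
      hle N (hkn.trans hnN)⟩, hlub, hrate₁, hrate₂, hrate₃⟩
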